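/- **Graphs and coefficients.** Graphs are finite and simple. A graph property $\Phi$ is an isomorphism-invariant function from graphs to $\{0,1\}$. For a graph $H$, an $H$-coloured graph is a graph $G$ with a homomorphism $c:G\to H$. A *fracture* of $H$ is a family $\rho=(\rho_v)_{v\in V(H)}$, where $\rho_v$ is a partition of the set of edges of $H$ incident to $v$; $\top$ is the fracture with a single block at each vertex. The *fractured graph* $H_\rho$ has a vertex $v^B$ for each $v\in V(H)$ and each block $B$ of $\rho_v$, and for each edge $e=\{v,w\}$ of $H$ an edge joining $v^B$ and $w^C$, where $e\in B\in\rho_v$ and $e\in C\in\rho_w$; it is $H$-coloured by $v^B\mapsto v$. The *coefficient function* of $\Phi$ and $H$ is the unique function $a_{\Phi,H}$ from the fractures of $H$ to $\mathbb Z$ such that for every $H$-coloured graph $(G,c)$ $$\#\{A\subseteq E(G): \#A=\#E(H),\ c(A)=E(H),\ \Phi(G[A])=1\}=\sum_{\rho}a_{\Phi,H}(\rho)\cdot\#\mathrm{Hom}_{\mathrm{cp}}(H_\rho,G),$$ where $G[A]$ is the graph $(V(G),A)$ without its isolated vertices and $\mathrm{Hom}_{\mathrm{cp}}$ denotes the set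 of colour-preserving homomorphisms. **The Peyerimhoff–Vdovina graphs.** Let $G=\langle x_0,x_1\mid r_1,r_2,r_3\rangle$ with $$r_1=(x_1x_0)^3x_1^{-3}x_0^{-3},\quad r_2=x_1x_0^{-1}x_1^{-1}x_0^{-3}x_1^2x_0^{-1}x_1x_0x_1,\quad r_3=x_1^3x_0^{-1}x_1x_0x_1x_0^2x_1^2x_0x_1x_0.$$ Let $\mathbb F_8=\mathbb F_2[g]$ with $g^3+g+1=0$, and let $\mathbb F_8[[\tau]]$ be the ring of skew power series with $\tau u=u^2\tau$ for $u\in\mathbb F_8$; its centre is $\mathbb F_2[[\tau^3]]$. The group $G$ maps to the units of $\mathbb F_8[[\tau]]$ modulo central units by $x_0\mapsto 1+\tau$, $x_1\mapsto 1+g\tau$. Let $N_i\trianglelefteq G$ consist of the elements whose image is represented by a unit congruent to $1$ modulo $\tau^{i+1}$; thus $G= N_0\supseteq N_1\supseteq N_2\supseteq\cdots$. **Statement.** Let $\Phi$ be a graph property and let $M$ be either $N_i$ for some $i\ge 2$ or, more generally, any normal subgroup of $G$ that is contained in $N_2$ and whose index is a power of $2$. Let $K=G/M$, let $v_0,v_1\in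 K$ be the images of $x_0,x_1$, and let $\Gamma$ be the Cayley graph of $K$ with respect to $\{v_0^{\pm1},v_1^{\pm1}\}$. Let $b_0,b_1,b_2,b_3$ be the orders of $v_0$, $v_1$, $v_1^{-1}v_0$, $v_1v_0$ in $K$, and let $a_j=\#K/b_j$. Then the coefficient function $a_{\Phi,\Gamma}$ exists and is unique, and $$a_{\Phi,\Gamma}(\top)\equiv\Phi(a_0 C_{b_0}+a_1 C_{b_1})+\Phi(a_2 C_{2b_2})+\Phi(a_3 C_{2b_3})+\Phi(\Gamma)\pmod 2 .$$ Moreover, all $a_j,b_j$ are powers of $2$, and $a_j\ge 8$. Here $C_n$ is the cycle of length $n$, $+$ is disjoint union, and $aC_n$ is the disjoint union of $a$ copies of $C_n$. -/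

import Mathlib

noncomputable section

/-! ### Graph properties, coloured edge subgraphs, and fractures -/

/-- A graph property: an isomorphism-invariant predicate on graphs. (Only its values on finite
graphs are ever used.) -/
structure GraphProperty where
  holds : ∀ {V : Type}, SimpleGraph V → Prop
  iso_invariant : ∀ {V W : Type} (G : SimpleGraph V) (G' : SimpleGraph W),
    Nonempty (G ≃g G') → (holds G ↔ holds G')

open Classical in
/-- The value `Φ(G) ∈ {0, 1}`. -/
def GraphProperty.val (Φ : GraphProperty) {V : Type} (G : SimpleGraph V) : ℤ :=
  if Φ.holds G then 1 else 0

/-- `G[A]` for a set `A` of edges: the graph `(V, A)` with all isolated vertices deleted. -/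
def edgeSubgraph {V : Type} (A : Set (Sym2 V)) :
    SimpleGraph (SimpleGraph.fromEdgeSet A).support :=
  (SimpleGraph.fromEdgeSet A).induce (SimpleGraph.fromEdgeSet A).support

/-- The sets `A` of `#E(H)` edges of the `H`-coloured graph `(G, c)` that contain every edge colour
and for which `G[A]` satisfies `Φ`. -/
def colEdgeSubs (Φ : GraphProperty) {V W : Type} {H : SimpleGraph W} (G : SimpleGraph V)
    (c : G →g H) : Set (Set (Sym2 V)) :=
  {A | A ⊆ G.edgeSet ∧ A.ncard = H.edgeSet.ncard ∧ Sym2.map c '' A = H.edgeSet ∧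
    Φ.holds (edgeSubgraph A)}

/-- A fracture of `H`: for every vertex `v` a partition (given as an equivalence relation) of the
set of edges incident to `v`. The order is pointwise refinement; `⊤` has a single block at each
vertex. -/
abbrev Fracture {W : Type} (H : SimpleGraph W) : Type :=
  ∀ v : W, Setoid (H.incidenceSet v)

/-- The fractured graph: its vertices `v^B` are the pairs of a vertex `v` of `H` and a block `B` of
`ρ v`; every edge `e = {v, w}` of `H` yields the edge joining `v^B` and `w^C`, where `B ∋ e` and
`C ∋ e` are the blocks of `e` at `v` and at `w`. -/
def fracturedGraph {W : Type} (H : SimpleGraph W) (ρ : Fracture H) :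
    SimpleGraph (Σ v : W, Quotient (ρ v)) where
  Adj x y := x.1 ≠ y.1 ∧ ∃ (e : Sym2 W) (hx : e ∈ H.incidenceSet x.1)
    (hy : e ∈ H.incidenceSet y.1), Quotient.mk (ρ x.1) ⟨e, hx⟩ = x.2 ∧
      Quotient.mk (ρ y.1) ⟨e, hy⟩ = y.2
  symm := ⟨by
    rintro x y ⟨hne, e, hx, hy, h1, h2⟩
    exact ⟨hne.symm, e, hy, hx, h2, h1⟩⟩
  loopless := ⟨fun _ h => h.1 rfl⟩

/-- The colour-preserving homomorphisms from the fractured graph of `ρ`, coloured by `v^B ↦ v`, to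
the `H`-coloured graph `(G, c)`. -/
def colHoms {V W : Type} {H : SimpleGraph W} (ρ : Fracture H) (G : SimpleGraph V) (c : G →g H) :
    Set (fracturedGraph H ρ →g G) :=
  {f | ∀ x, c (f x) = x.1}

/-- `a` is a coefficient function of `Φ` and `H`: on every finite `H`-coloured graph it expresses
the number of colourful edge subsets satisfying `Φ` as the linear combination of the numbers of
colour-preserving homomorphisms from the fractured graphs of `H`. -/
def IsCoefficientFunction (Φ : GraphProperty) {W : Type} (H : SimpleGraph W)
    (a : Fracture H → ℤ) : Prop :=
  ∀ (V : Type) [Finite V] (G : SimpleGraph V) (c : G →g H),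
    ((colEdgeSubs Φ G c).ncard : ℤ) = ∑ᶠ ρ : Fracture H, a ρ * ((colHoms ρ G c).ncard : ℤ)

/-- The disjoint union of `a` copies of `G`. -/
def copies (a : ℕ) {V : Type} (G : SimpleGraph V) : SimpleGraph (Fin a × V) where
  Adj x y := x.1 = y.1 ∧ G.Adj x.2 y.2
  symm := ⟨fun _ _ h => ⟨h.1.symm, h.2.symm⟩⟩
  loopless := ⟨fun _ h => G.irrefl h.2⟩

/-! ### The group of Peyerimhoff and Vdovina and its tower of normal subgroups -/

namespace PV

/-- The free generators. -/
def x (i : Fin 2) : FreeGroup (Fin 2) := FreeGroup.of i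

/-- The three defining relators. -/
def relators : Set (FreeGroup (Fin 2)) :=
  {x 1 * x 0 * x 1 * x 0 * x 1 * x 0 * (x 1 ^ 3)⁻¹ * (x 0 ^ 3)⁻¹,
   x 1 * (x 0)⁻¹ * (x 1)⁻¹ * (x 0 ^ 3)⁻¹ * x 1 ^ 2 * (x 0)⁻¹ * x 1 * x 0 * x 1,
   x 1 ^ 3 * (x 0)⁻¹ * x 1 * x 0 * x 1 * x 0 ^ 2 * x 1 ^ 2 * x 0 * x 1 * x 0}

/-- The infinite group `⟨x₀, x₁ | r₁, r₂, r₃⟩`. -/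
abbrev PVGroup : Type := PresentedGroup relators

/-- The ring `M(3, 𝔽₂)`. -/
abbrev M3 : Type := Matrix (Fin 3) (Fin 3) (ZMod 2)

/-- The companion matrix of `X³ + X + 1`; it generates a copy of the field with `8` elements inside
`M(3, 𝔽₂)`. -/
def g : M3 := !![0, 0, 1; 1, 0, 1; 0, 1, 0]

/-- Upper triangular `n × n` matrices over `M(3, 𝔽₂)`. A skew power series `∑ aₖ τᵏ` over `𝔽₈`
(with `τ a = a² τ`), truncated modulo `τⁿ`, corresponds to the matrix with entry `aₖ ^ (2 ^ j)` in
position `(j, j + k)`. -/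
abbrev Mat (n : ℕ) : Type := Matrix (Fin n) (Fin n) M3

/-- The matrix of `u τ`. -/
def upper (n : ℕ) (u : M3) : Mat n :=
  Matrix.of fun j k => if (j : ℕ) + 1 = k then u ^ (2 ^ (j : ℕ)) else 0

/-- The matrix of `τ³`, which is central as `a ^ 8 = a` for all `a ∈ 𝔽₈`. -/
def tauCubed (n : ℕ) : Mat n :=
  Matrix.of fun j k => if (j : ℕ) + 3 = k then 1 else 0

theorem upper_pow_apply (n : ℕ) (u : M3) (m : ℕ) (j k : Fin n) (h : (k : ℕ) < j + m) :
    (upper n u ^ m) j k = 0 := by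
  induction m generalizing k with
  | zero =>
    rw [pow_zero, Matrix.one_apply_ne]
    rintro rfl
    omega
  | succ m ih =>
    rw [pow_succ, Matrix.mul_apply]
    refine Finset.sum_eq_zero fun l _ => ?_
    by_cases hl : (l : ℕ) + 1 = k
    · rw [ih l (by omega), zero_mul]
    · simp [upper, hl]

theorem upper_isNilpotent (n : ℕ) (u : M3) : IsNilpotent (upper n u) :=
  ⟨n, by
    ext1 j k
    rw [upper_pow_apply n u n j k (by have := k.2; omega)]
    rfl⟩

/-- The unit `1 + u τ`. -/
def unip (n : ℕ) (u : M3) : (Mat n)ˣ := (upper_isNilpotent n u).isUnit_one_add.unit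

/-- The homomorphism from the free group to the units given by `x₀ ↦ 1 + τ`, `x₁ ↦ 1 + g τ`.
It induces an embedding of `PVGroup` into the units of the skew power series ring modulo its
centre `𝔽₂⟦τ³⟧`. -/
def rep (n : ℕ) : FreeGroup (Fin 2) →* (Mat n)ˣ := FreeGroup.lift ![unip n 1, unip n g]

theorem upper_comm (n : ℕ) {u : M3} (hu : u ^ 8 = u) :
    Commute (upper n u) (tauCubed n) := by
  have key : ∀ j : ℕ, u ^ (2 ^ (j + 3)) = u ^ (2 ^ j) := fun j => by
    rw [pow_add, mul_comm, pow_mul]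
    norm_num [hu]
  ext1 j l
  rw [Matrix.mul_apply, Matrix.mul_apply]
  by_cases h : (j : ℕ) + 4 = l
  · rw [Finset.sum_eq_single (⟨j + 1, by omega⟩ : Fin n),
      Finset.sum_eq_single (⟨j + 3, by omega⟩ : Fin n)]
    · simp [upper, tauCubed, h, key]
    · intro b _ hb
      have : (j : ℕ) + 3 ≠ b := fun h' => hb (Fin.ext h'.symm)
      simp [tauCubed, this]
    · simp
    · intro b _ hb
      have : (j : ℕ) + 1 ≠ b := fun h' => hb (Fin.ext h'.symm)
      simp [upper, this]
    · simp
  · rw [Finset.sum_eq_zero, Finset.sum_eq_zero]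
    · intro b _
      by_cases h1 : (j : ℕ) + 3 = b
      · have : (b : ℕ) + 1 ≠ l := by omega
        simp [upper, this]
      · simp [tauCubed, h1]
    · intro b _
      by_cases h1 : (j : ℕ) + 1 = b
      · have : (b : ℕ) + 3 ≠ l := by omega
        simp [tauCubed, this]
      · simp [upper, h1]

theorem unip_comm (n : ℕ) {u : M3} (hu : u ^ 8 = u) {c : Mat n}
    (hc : c ∈ Algebra.adjoin (ZMod 2) {tauCubed n}) : Commute (unip n u : Mat n) c := by
  have h0 : (unip n u : Mat n) = 1 + upper n u := rfl
  rw [h0]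
  refine (Commute.one_left c).add_left ?_
  induction hc using Algebra.adjoin_induction with
  | mem y hy =>
    rw [Set.mem_singleton_iff.1 hy]
    exact upper_comm n hu
  | algebraMap r => exact (Algebra.commutes r _).symm
  | add y z _ _ hy hz => exact hy.add_right hz
  | mul y z _ _ hy hz => exact hy.mul_right hz

theorem rep_comm (n : ℕ) (w : FreeGroup (Fin 2)) {c : (Mat n)ˣ}
    (hc : (c : Mat n) ∈ Algebra.adjoin (ZMod 2) {tauCubed n}) : Commute (rep n w) c := by
  have hg : g ^ 8 = g := by decide
  have h0 : Commute (unip n 1) c := Units.ext (unip_comm n (one_pow 8) hc)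
  have h1 : Commute (unip n g) c := Units.ext (unip_comm n hg hc)
  have hof : ∀ i : Fin 2, Commute (rep n (FreeGroup.of i)) c := fun i => by
    rw [rep, FreeGroup.lift_apply_of]
    match i with
    | 0 => exact h0
    | 1 => exact h1
  refine FreeGroup.induction_on (C := fun w => Commute (rep n w) c) w ?_ hof ?_ ?_
  · rw [map_one]
    exact Commute.one_left c
  · intro i h
    rw [map_inv]
    exact (hof i).inv_left
  · intro y z hy hz
    rw [map_mul]
    exact hy.mul_left hz

/-- The words whose truncation modulo `τⁿ` lies in the central subring `𝔽₂[τ³]`. -/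
def centralWords (n : ℕ) : Subgroup (FreeGroup (Fin 2)) where
  carrier := {w | ((rep n w : (Mat n)ˣ) : Mat n) ∈ Algebra.adjoin (ZMod 2) {tauCubed n}}
  mul_mem' := by
    intro v w hv hw
    simp only [Set.mem_ofPred_eq, map_mul, Units.val_mul] at *
    exact mul_mem hv hw
  one_mem' := by
    simp only [Set.mem_ofPred_eq, map_one, Units.val_one]
    exact one_mem _
  inv_mem' := by
    intro w hw
    have : Finite (Mat n) := inferInstanceAs (Finite (Fin n → Fin n → Fin 3 → Fin 3 → ZMod 2))
    have h1 : (rep n w)⁻¹ = rep n w ^ (orderOf (rep n w) - 1) := by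
      rw [inv_eq_iff_mul_eq_one, ← pow_succ',
        Nat.sub_add_cancel (orderOf_pos (rep n w)), pow_orderOf_eq_one]
    simp only [Set.mem_ofPred_eq, map_inv, h1, Units.val_pow_eq_pow_val] at *
    exact pow_mem hw _

instance centralWords_normal (n : ℕ) : (centralWords n).Normal where
  conj_mem := by
    intro w hw v
    have h : rep n (v * w * v⁻¹) = rep n w := by
      rw [map_mul, map_mul, map_inv, (rep_comm n v hw).eq, mul_inv_cancel_right]
    change ((rep n (v * w * v⁻¹) : (Mat n)ˣ) : Mat n) ∈ Algebra.adjoin (ZMod 2) {tauCubed n}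
    rw [h]
    exact hw

/-- The tower `N₀ ⊇ N₁ ⊇ N₂ ⊇ ⋯` : the subgroup `N i` consists of the elements of `PVGroup` that
are congruent to `1` modulo `τ ^ (i + 1)`, up to the centre. -/
def N (i : ℕ) : Subgroup PVGroup :=
  (centralWords (i + 1)).map (PresentedGroup.mk relators)

instance N_normal (i : ℕ) : (N i).Normal :=
  (centralWords_normal (i + 1)).map _ (PresentedGroup.mk_surjective relators)

/-- The image `v_i` of `x_i` in a quotient group of `PVGroup`. -/
def v (M : Subgroup PVGroup) [M.Normal] (i : Fin 2) : PVGroup ⧸ M :=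
  QuotientGroup.mk (PresentedGroup.of i)

/-- The Cayley graph of `PVGroup ⧸ M` with respect to `{v₀, v₀⁻¹, v₁, v₁⁻¹}`. -/
def graph (M : Subgroup PVGroup) [M.Normal] : SimpleGraph (PVGroup ⧸ M) :=
  SimpleGraph.mulCayley {v M 0, (v M 0)⁻¹, v M 1, (v M 1)⁻¹}

/-- `b₀, b₁, b₂, b₃` are the orders of `v₀`, `v₁`, `v₁⁻¹ v₀`, `v₁ v₀`. -/
def b (M : Subgroup PVGroup) [M.Normal] (j : Fin 4) : ℕ :=
  orderOf ((![v M 0, v M 1, (v M 1)⁻¹ * v M 0, v M 1 * v M 0] : Fin 4 → PVGroup ⧸ M) j)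

/-- `a_j = #(PVGroup ⧸ M) / b_j`. -/
def a (M : Subgroup PVGroup) [M.Normal] (j : Fin 4) : ℕ :=
  Nat.card (PVGroup ⧸ M) / b M j

end PV

end

/-! ### Edge sections and the characterisation of coefficient functions -/

/-! Why the theorem holds. A colourful set of `#E(H)` edges contains exactly one edge of each
colour, so it is an edge section `p`. The graph it spans is the fractured graph of `p.fracture`, and
the colour-preserving homomorphisms from `H_ρ` are the sections with `ρ ≤ p.fracture`. The defining
identity thus compares two sums over sections. Testing it on `H_σ`, which has a single section,
shows that it amounts to `∑_{ρ ≤ σ} a ρ = Φ(H_σ)` for all `σ` (`isCoefficientFunction_iff`). Möbius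
inversion gives existence and uniqueness (`existsUnique_sum_le`).

For a Cayley graph of a 2-group `K`, uniqueness makes the coefficients invariant under left
translation, so modulo 2 only the translation-invariant fractures contribute. These are given by a
single partition of the generators. A partition with `k` blocks is compatible with `2^(k-1)`
normalised two-colourings of the generators, an odd number only for `k = 1`. Hence summing `Φ` over
the partitions with at most two blocks isolates the coefficient of `⊤` (`coefficient_top`). With
generators `a, a⁻¹, b, b⁻¹` there are eight such partitions: one block gives `Γ`; the three
splittings into pairs give unions of cycles; the four that split off one generator cancel in pairs,
since splitting off `s` or `s⁻¹` gives isomorphic graphs.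

For the group at hand, truncation modulo `τ³` gives an affine action on `𝔽₂⁶` that factors through
`G/M`. Its image has at least 32 elements, while the four elements in question have fourth power 1
there. This bounds the `a_j` below by 8 and shows that the generators are distinct and not
involutions. -/

section Sections

variable {V W : Type} {H : SimpleGraph W}

/-- A choice, for every edge `e` of `H` and every end `v` of `e`, of a vertex of colour `v` in `G`,
such that the vertices chosen for the two ends of an edge are adjacent. -/
abbrev EdgeSection (G : SimpleGraph V) (c : G →g H) : Type :=
  {p : ∀ v, H.incidenceSet v → V // (∀ v e, c (p v e) = v) ∧
    ∀ v w e (hv : e ∈ H.incidenceSet v) (hw : e ∈ H.incidenceSet w), v ≠ w →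
      G.Adj (p v ⟨e, hv⟩) (p w ⟨e, hw⟩)}

instance EdgeSection.finite [Finite V] [Finite W] (G : SimpleGraph V) (c : G →g H) :
    Finite (EdgeSection G c) :=
  Subtype.finite

variable {G : SimpleGraph V} {c : G →g H}

/-- The fracture recording which ends of edges are identified by an edge section. -/
@[reducible] def EdgeSection.fracture (p : EdgeSection G c) : Fracture H := fun v => Setoid.ker (p.1 v)

/-- The subgraph of `G` formed by the chosen edges. -/
def EdgeSection.graph (p : EdgeSection G c) : SimpleGraph V where
  Adj x y := c x ≠ c y ∧ ∃ (e : Sym2 W) (hx : e ∈ H.incidenceSet (c x))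
    (hy : e ∈ H.incidenceSet (c y)), p.1 _ ⟨e, hx⟩ = x ∧ p.1 _ ⟨e, hy⟩ = y
  symm := ⟨by
    rintro x y ⟨hne, e, hx, hy, h1, h2⟩
    exact ⟨hne.symm, e, hy, hx, h2, h1⟩⟩
  loopless := ⟨fun _ h => h.1 rfl⟩

theorem eq_mk_of_mem_incidenceSet {v w : W} {e : Sym2 W} (hvw : v ≠ w)
    (hv : e ∈ H.incidenceSet v) (hw : e ∈ H.incidenceSet w) : e = s(v, w) :=
  (Sym2.mem_and_mem_iff hvw).1 ⟨hv.2, hw.2⟩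

theorem exists_other_end {v : W} {e : Sym2 W} (he : e ∈ H.incidenceSet v) :
    ∃ w, v ≠ w ∧ e = s(v, w) ∧ e ∈ H.incidenceSet w := by
  obtain ⟨h1, w, rfl⟩ := he
  exact ⟨w, h1.ne, rfl, h1, Sym2.mem_mk_right _ _⟩

/-- Colour-preserving homomorphisms from a fractured graph are the edge sections that identify at
least the ends lying in a common block. -/
def colHomsEquiv (ρ : Fracture H) (G : SimpleGraph V) (c : G →g H) :
    colHoms ρ G c ≃ {p : EdgeSection G c // ρ ≤ p.fracture} where
  toFun f := ⟨⟨fun v e => f.1 ⟨v, Quotient.mk _ e⟩, fun v e => f.2 ⟨v, Quotient.mk _ e⟩,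
    fun _ _ e hv hw hne => f.1.map_rel ⟨hne, e, hv, hw, rfl, rfl⟩⟩,
    fun v e e' h => congrArg (fun q => f.1 ⟨v, q⟩) (Quotient.sound h)⟩
  invFun p := ⟨⟨fun x => Quotient.lift (p.1.1 x.1) (fun _ _ h => p.2 x.1 h) x.2, by
      rintro ⟨v, q⟩ ⟨w, r⟩ ⟨hne, e, hv, hw, h1, h2⟩
      induction q using Quotient.inductionOn with | h e₁ =>
      induction r using Quotient.inductionOn with | h e₂ =>
      have h3 : p.1.1 v ⟨e, hv⟩ = p.1.1 v e₁ := p.2 v (Quotient.exact h1)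
      have h4 : p.1.1 w ⟨e, hw⟩ = p.1.1 w e₂ := p.2 w (Quotient.exact h2)
      change G.Adj (p.1.1 v e₁) (p.1.1 w e₂)
      rw [← h3, ← h4]
      exact p.1.2.2 v w e hv hw hne⟩, by
      rintro ⟨v, q⟩
      induction q using Quotient.inductionOn with
      | h e => exact p.1.2.1 v e⟩
  left_inv f := by
    apply Subtype.ext
    apply DFunLike.ext
    rintro ⟨v, q⟩
    induction q using Quotient.inductionOn with
    | h e => rfl
  right_inv p := rfl

theorem EdgeSection.graph_adj (p : EdgeSection G c) {v w : W} {e : Sym2 W} (hne : v ≠ w)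
    (hv : e ∈ H.incidenceSet v) (hw : e ∈ H.incidenceSet w) :
    p.graph.Adj (p.1 v ⟨e, hv⟩) (p.1 w ⟨e, hw⟩) := by
  -- The colours of the chosen vertices equal `v` and `w` only propositionally, so they are
  -- generalised before substituting.
  have h : ∀ (v' w' : W) (_ : v' = v) (_ : w' = w), v' ≠ w' ∧ ∃ (e' : Sym2 W)
      (hx : e' ∈ H.incidenceSet v') (hy : e' ∈ H.incidenceSet w'),
      p.1 _ ⟨e', hx⟩ = p.1 v ⟨e, hv⟩ ∧ p.1 _ ⟨e', hy⟩ = p.1 w ⟨e, hw⟩ := by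
    rintro _ _ rfl rfl
    exact ⟨hne, e, hv, hw, rfl, rfl⟩
  exact h _ _ (p.2.1 _ _) (p.2.1 _ _)

theorem EdgeSection.graph_adj_iff (p : EdgeSection G c) {x y : V} :
    p.graph.Adj x y ↔ ∃ (v w : W) (_ : v ≠ w) (e : Sym2 W) (hv : e ∈ H.incidenceSet v)
      (hw : e ∈ H.incidenceSet w), p.1 v ⟨e, hv⟩ = x ∧ p.1 w ⟨e, hw⟩ = y := by
  constructor
  · rintro ⟨hne, e, hx, hy, h⟩
    exact ⟨_, _, hne, e, hx, hy, h⟩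
  · rintro ⟨v, w, hne, e, hv, hw, rfl, rfl⟩
    exact p.graph_adj hne hv hw

theorem EdgeSection.graph_le (p : EdgeSection G c) : p.graph ≤ G := by
  intro x y h
  obtain ⟨v, w, hne, e, hv, hw, rfl, rfl⟩ := p.graph_adj_iff.1 h
  exact p.2.2 _ _ _ _ _ hne

theorem EdgeSection.map_image_edgeSet (p : EdgeSection G c) :
    Sym2.map c '' p.graph.edgeSet = H.edgeSet := by
  ext e
  constructor
  · rintro ⟨e', he', rfl⟩
    induction e' using Sym2.ind with
    | h x y => exact c.map_adj (p.graph_le he')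
  · intro he
    induction e using Sym2.ind with
    | h v w =>
      exact ⟨s(p.1 v ⟨s(v, w), he, Sym2.mem_mk_left _ _⟩, p.1 w ⟨s(v, w), he, Sym2.mem_mk_right _ _⟩),
        p.graph_adj (SimpleGraph.Adj.ne he) _ _, by simp [p.2.1]⟩

/-- The colour of a chosen edge is the edge `e` of `H` for which it was chosen. -/
theorem EdgeSection.map_injOn (p : EdgeSection G c) :
    Set.InjOn (Sym2.map c) p.graph.edgeSet := by
  intro e1 h1 e2 h2 h
  induction e1 using Sym2.ind with | h x y =>
  induction e2 using Sym2.ind with | h x' y' =>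
  obtain ⟨v, w, hne, e, hv, hw, rfl, rfl⟩ := p.graph_adj_iff.1 h1
  obtain ⟨v', w', hne', e', hv', hw', rfl, rfl⟩ := p.graph_adj_iff.1 h2
  simp only [Sym2.map_mk, p.2.1] at h
  have h3 := eq_mk_of_mem_incidenceSet hne hv hw
  have h4 := eq_mk_of_mem_incidenceSet hne' hv' hw'
  have h5 : e = e' := by rw [h3, h4, h]
  subst h5
  rcases Sym2.eq_iff.1 h with ⟨rfl, rfl⟩ | ⟨rfl, rfl⟩
  · rfl
  · exact Sym2.eq_swap

/-- The chosen edges form the fractured graph, up to isolated vertices. -/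
theorem EdgeSection.nonempty_iso (p : EdgeSection G c) :
    Nonempty (fracturedGraph H p.fracture ≃g edgeSubgraph p.graph.edgeSet) := by
  have key : ∀ x : Σ v : W, Quotient (p.fracture v),
      Quotient.lift (p.1 x.1) (fun _ _ h => h) x.2 ∈
        (SimpleGraph.fromEdgeSet p.graph.edgeSet).support := by
    rintro ⟨v, q⟩
    induction q using Quotient.inductionOn with
    | h e =>
      obtain ⟨w, hne, -, hw⟩ := exists_other_end e.2
      rw [SimpleGraph.fromEdgeSet_edgeSet]
      exact ⟨_, p.graph_adj hne e.2 hw⟩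
  refine ⟨⟨Equiv.ofBijective (fun x => ⟨_, key x⟩) ⟨?_, ?_⟩, ?_⟩⟩
  · rintro ⟨v, q⟩ ⟨w, r⟩ h
    induction q using Quotient.inductionOn with | h e =>
    induction r using Quotient.inductionOn with | h f =>
    have h' : p.1 v e = p.1 w f := congrArg Subtype.val h
    have hvw : v = w := by rw [← p.2.1 v e, h', p.2.1]
    subst hvw
    exact congrArg (Sigma.mk v) (Quotient.sound h')
  · rintro ⟨x, hx⟩
    rw [SimpleGraph.fromEdgeSet_edgeSet] at hx
    obtain ⟨y, -, e, hx, -, h, -⟩ := hx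
    exact ⟨⟨c x, Quotient.mk _ ⟨e, hx⟩⟩, Subtype.ext h⟩
  · rintro ⟨v, q⟩ ⟨w, r⟩
    induction q using Quotient.inductionOn with | h e =>
    induction r using Quotient.inductionOn with | h f =>
    change (SimpleGraph.fromEdgeSet p.graph.edgeSet).Adj (p.1 v e) (p.1 w f) ↔ _
    rw [SimpleGraph.fromEdgeSet_edgeSet, p.graph_adj_iff]
    constructor
    · rintro ⟨v', w', hne, e', hv, hw, h1, h2⟩
      have hv' : v' = v := by rw [← p.2.1 v e, ← h1, p.2.1]
      have hw' : w' = w := by rw [← p.2.1 w f, ← h2, p.2.1]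
      subst hv' hw'
      exact ⟨hne, e', hv, hw, Quotient.sound h1, Quotient.sound h2⟩
    · rintro ⟨hne, e', hv, hw, h1, h2⟩
      exact ⟨v, w, hne, e', hv, hw, Quotient.exact h1, Quotient.exact h2⟩

/-- The vertex `p v e` can be read off as the end of colour `v` of the only chosen edge with colour
`e`. -/
theorem EdgeSection.graph_injective :
    Function.Injective (fun p : EdgeSection G c => p.graph.edgeSet) := by
  intro p q h
  replace h : p.graph = q.graph := SimpleGraph.edgeSet_injective h
  apply Subtype.ext
  funext v ⟨e, he⟩
  obtain ⟨w, hne, h1, hw⟩ := exists_other_end he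
  have h2 := p.graph_adj hne he hw
  rw [h, q.graph_adj_iff] at h2
  obtain ⟨v', w', hne', e', hv', hw', h3, h4⟩ := h2
  have hv : v' = v := by rw [← p.2.1 v ⟨e, he⟩, ← h3, q.2.1]
  have hw : w' = w := by rw [← p.2.1 w ⟨e, hw⟩, ← h4, q.2.1]
  subst hv hw
  obtain rfl : e = e' := by rw [h1, eq_mk_of_mem_incidenceSet hne' hv' hw']
  exact h3.symm

theorem EdgeSection.exists_of_injOn {A : Set (Sym2 V)} (hA : A ⊆ G.edgeSet)
    (hinj : Set.InjOn (Sym2.map c) A) (himg : Sym2.map c '' A = H.edgeSet) :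
    ∃ p : EdgeSection G c, p.graph.edgeSet = A := by
  have h1 : ∀ (v : W) (e : H.incidenceSet v), ∃ x y, s(x, y) ∈ A ∧ c x = v ∧
      s(c x, c y) = (e : Sym2 W) := by
    rintro v ⟨e, he⟩
    obtain ⟨w, hne, rfl, -⟩ := exists_other_end he
    have h := he.1
    rw [← himg] at h
    obtain ⟨a, ha, h⟩ := h
    induction a using Sym2.ind with | h x y =>
    rw [Sym2.map_mk] at h
    rcases Sym2.eq_iff.1 h with ⟨h2, h3⟩ | ⟨h2, h3⟩
    · exact ⟨x, y, ha, h2, h⟩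
    · exact ⟨y, x, Sym2.eq_swap ▸ ha, h3, Sym2.eq_swap.trans h⟩
  choose p q hpq hp he using h1
  -- By injectivity on `A` the choice does not depend on the end used; a swapped match would give an
  -- edge of `G` with both ends of the same colour.
  have huniq : ∀ x y, s(x, y) ∈ A → ∀ v e (h : e ∈ H.incidenceSet v), c x = v →
      e = s(c x, c y) → p v ⟨e, h⟩ = x := by
    rintro x y hxy _ _ h rfl rfl
    have h2 := hinj (hpq (c x) ⟨_, h⟩) hxy (he _ _)
    rcases Sym2.eq_iff.1 h2 with ⟨h3, -⟩ | ⟨h3, -⟩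
    · exact h3
    · have h4 := hp (c x) ⟨_, h⟩
      rw [h3] at h4
      exact absurd h4 (c.map_adj (hA hxy)).ne'
  have hmem : ∀ v w e (hv : e ∈ H.incidenceSet v) (hw : e ∈ H.incidenceSet w), v ≠ w →
      s(p v ⟨e, hv⟩, p w ⟨e, hw⟩) ∈ A := by
    intro v w e hv hw hne
    have h2 := he v ⟨e, hv⟩
    have h3 := hpq v ⟨e, hv⟩
    have h4 := hp v ⟨e, hv⟩
    have h5 := eq_mk_of_mem_incidenceSet hne hv hw
    have h6 : c (q v ⟨e, hv⟩) = w := by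
      have h7 : s(c (p v ⟨e, hv⟩), c (q v ⟨e, hv⟩)) = s(v, w) := h2.trans h5
      rw [h4] at h7
      exact Sym2.congr_right.1 h7
    have h8 : p w ⟨e, hw⟩ = q v ⟨e, hv⟩ :=
      huniq _ _ (Sym2.eq_swap ▸ h3) w e hw h6 (by rw [h4, h6, Sym2.eq_swap, ← h5])
    rw [h8]
    exact h3
  let P : EdgeSection G c := ⟨p, hp, fun v w e hv hw hne => hA (hmem v w e hv hw hne)⟩
  refine ⟨P, ?_⟩
  ext a
  induction a using Sym2.ind with | h x y =>
  rw [SimpleGraph.mem_edgeSet, P.graph_adj_iff]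
  constructor
  · rintro ⟨v, w, hne, e, hv, hw, rfl, rfl⟩
    exact hmem v w e hv hw hne
  · intro hxy
    have hadj := c.map_adj (hA hxy)
    refine ⟨c x, c y, hadj.ne, s(c x, c y), ⟨hadj, Sym2.mem_mk_left _ _⟩,
      ⟨hadj, Sym2.mem_mk_right _ _⟩, huniq x y hxy _ _ _ rfl rfl,
      huniq y x (Sym2.eq_swap ▸ hxy) _ _ _ rfl Sym2.eq_swap⟩

/-- Colourful edge subsets satisfying `Φ` are the edge sections whose fractured graph satisfies
`Φ`. -/
theorem ncard_colEdgeSubs [Finite V] (Φ : GraphProperty) :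
    (colEdgeSubs Φ G c).ncard =
      Nat.card {p : EdgeSection G c // Φ.holds (fracturedGraph H p.fracture)} := by
  rw [← Nat.card_coe_set_eq]
  refine (Nat.card_congr (Equiv.ofBijective (fun p => ⟨p.1.graph.edgeSet,
    SimpleGraph.edgeSet_mono p.1.graph_le, ?_, p.1.map_image_edgeSet,
    (Φ.iso_invariant _ _ p.1.nonempty_iso).1 p.2⟩) ⟨?_, ?_⟩)).symm
  rotate_right
  · rw [← p.1.map_image_edgeSet, p.1.map_injOn.ncard_image]
  · intro p q h
    exact Subtype.ext (EdgeSection.graph_injective (congrArg Subtype.val h))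
  · rintro ⟨A, h1, h2, h3, h4⟩
    -- A finite set mapping onto a set of the same size is mapped injectively: one edge per colour.
    have hinj : Set.InjOn (Sym2.map c) A :=
      Set.injOn_of_ncard_image_eq (by rw [h3, h2]) (Set.toFinite A)
    obtain ⟨p, rfl⟩ := EdgeSection.exists_of_injOn h1 hinj h3
    exact ⟨⟨p, (Φ.iso_invariant _ _ p.nonempty_iso).2 h4⟩, rfl⟩

theorem ncard_colHoms (ρ : Fracture H) :
    (colHoms ρ G c).ncard = Nat.card {p : EdgeSection G c // ρ ≤ p.fracture} := by
  rw [← Nat.card_coe_set_eq]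
  exact Nat.card_congr (colHomsEquiv ρ G c)

/-- The colouring of the fractured graph. -/
def fracturedGraphColouring (H : SimpleGraph W) (σ : Fracture H) : fracturedGraph H σ →g H where
  toFun x := x.1
  map_rel' := by
    rintro ⟨v, q⟩ ⟨w, r⟩ ⟨hne, e, hv, hw, -⟩
    have h := hv.1
    rwa [eq_mk_of_mem_incidenceSet hne hv hw] at h

/-- The unique edge section of a fractured graph. -/
def fracturedGraphSection (H : SimpleGraph W) (σ : Fracture H) :
    EdgeSection (fracturedGraph H σ) (fracturedGraphColouring H σ) :=
  ⟨fun v e => ⟨v, Quotient.mk _ e⟩, fun _ _ => rfl,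
    fun _ _ e hv hw hne => ⟨hne, e, hv, hw, rfl, rfl⟩⟩

theorem fracturedGraphSection_fracture (H : SimpleGraph W) (σ : Fracture H) :
    (fracturedGraphSection H σ).fracture = σ := by
  funext v
  ext e f
  constructor
  · intro h
    have h' : (⟨v, Quotient.mk _ e⟩ : Σ v : W, Quotient (σ v)) = ⟨v, Quotient.mk _ f⟩ := h
    exact Quotient.exact (eq_of_heq (Sigma.mk.inj h').2)
  · intro h
    exact congrArg (Sigma.mk v) (Quotient.sound h)

/-- An edge of the fractured graph is witnessed by an edge of `H`, which its two colours determine;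
so the end of colour `v` must be the block of that edge. -/
theorem eq_fracturedGraphSection {σ : Fracture H}
    (p : EdgeSection (fracturedGraph H σ) (fracturedGraphColouring H σ)) :
    p = fracturedGraphSection H σ := by
  apply Subtype.ext
  funext v ⟨e, he⟩
  obtain ⟨w, hne, h1, hw⟩ := exists_other_end he
  obtain ⟨hne', e', hv', hw', h2, h3⟩ := p.2.2 v w e he hw hne
  have hv : (p.1 v ⟨e, he⟩).1 = v := p.2.1 _ _
  have hw2 : (p.1 w ⟨e, hw⟩).1 = w := p.2.1 _ _
  have hee : e' = e := by
    rw [eq_mk_of_mem_incidenceSet hne' hv' hw', hv, hw2, h1]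
  subst hee
  change _ = (⟨v, Quotient.mk _ ⟨e', he⟩⟩ : Σ v : W, Quotient (σ v))
  generalize p.1 v ⟨e', he⟩ = x at *
  obtain ⟨v', q⟩ := x
  obtain rfl : v' = v := hv
  exact congrArg (Sigma.mk v') h2.symm

end Sections

/-! ### Coefficient functions via Möbius inversion -/

section Coefficients

variable {W : Type} [Finite W] {H : SimpleGraph W}

theorem natCard_subtype_eq_sum {α : Type*} [Fintype α] (P : α → Prop) [DecidablePred P] :
    (Nat.card {x // P x} : ℤ) = ∑ x, if P x then 1 else 0 := by
  rw [Nat.card_eq_fintype_card, Fintype.card_subtype, Finset.sum_boole]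

open Classical in
/-- Coefficient functions are the Möbius inverses of `σ ↦ Φ(H_σ)`. -/
theorem isCoefficientFunction_iff [Fintype (Fracture H)] (Φ : GraphProperty)
    (a : Fracture H → ℤ) :
    IsCoefficientFunction Φ H a ↔
      ∀ σ, ∑ ρ, (if ρ ≤ σ then a ρ else 0) = Φ.val (fracturedGraph H σ) := by
  -- Both sides of the defining identity become sums over edge sections `p` of terms that depend
  -- only on `p.fracture`.
  have key : ∀ (V : Type) [Finite V] (G : SimpleGraph V) (c : G →g H)
      [Fintype (EdgeSection G c)],
      (((colEdgeSubs Φ G c).ncard : ℤ) =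
        ∑ p : EdgeSection G c, Φ.val (fracturedGraph H p.fracture)) ∧
      (∑ᶠ ρ : Fracture H, a ρ * ((colHoms ρ G c).ncard : ℤ) =
        ∑ p : EdgeSection G c, ∑ ρ, (if ρ ≤ p.fracture then a ρ else 0)) := by
    intro V _ G c _
    constructor
    · rw [ncard_colEdgeSubs, natCard_subtype_eq_sum]
      rfl
    · rw [finsum_eq_sum_of_fintype, Finset.sum_comm]
      refine Finset.sum_congr rfl fun ρ _ => ?_
      rw [ncard_colHoms, natCard_subtype_eq_sum, Finset.mul_sum]
      simp
  constructor
  · intro h σ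
    have : Finite (Σ v : W, Quotient (σ v)) := inferInstance
    have h1 := h _ (fracturedGraph H σ) (fracturedGraphColouring H σ)
    let _ : Unique (EdgeSection (fracturedGraph H σ) (fracturedGraphColouring H σ)) :=
      ⟨⟨fracturedGraphSection H σ⟩, eq_fracturedGraphSection⟩
    obtain ⟨h2, h3⟩ := key _ (fracturedGraph H σ) (fracturedGraphColouring H σ)
    have h4 : (default : EdgeSection (fracturedGraph H σ) (fracturedGraphColouring H σ)) =
      fracturedGraphSection H σ := rfl
    rw [h2, h3, Fintype.sum_unique, Fintype.sum_unique, h4, fracturedGraphSection_fracture] at h1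
    exact h1.symm
  · intro h V _ G c
    have := Fintype.ofFinite (EdgeSection G c)
    obtain ⟨h2, h3⟩ := key V G c
    rw [h2, h3]
    exact Finset.sum_congr rfl fun p _ => (h _).symm

open Classical in
/-- Möbius inversion on a finite partial order. -/
theorem existsUnique_sum_le {α : Type*} [PartialOrder α] [Fintype α] (F : α → ℤ) :
    ∃! a : α → ℤ, ∀ y, ∑ x, (if x ≤ y then a x else 0) = F y := by
  -- Isolating the term at `y` turns the system into a well-founded recursion for `a`.
  have split : ∀ (a : α → ℤ) y, ∑ x, (if x ≤ y then a x else 0) =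
      a y + ∑ x, if x < y then a x else 0 := by
    intro a y
    have h : ∀ x, (if x ≤ y then a x else 0) =
        (if x = y then a x else 0) + if x < y then a x else 0 := by
      intro x
      rcases eq_or_ne x y with rfl | hne
      · simp
      · simp [hne, lt_iff_le_and_ne]
    simp [h, Finset.sum_add_distrib]
  have wf : WellFounded ((· < ·) : α → α → Prop) := wellFounded_lt
  refine ⟨wf.fix fun y ih => F y - ∑ x, if h : x < y then ih x h else 0, ?_, ?_⟩
  · intro y
    rw [split, wf.fix_eq]
    simp
  · intro a ha
    funext y
    induction y using wf.induction with
    | _ y ih =>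
      rw [wf.fix_eq, ← ha y, split, eq_sub_iff_add_eq]
      congr 1
      refine Finset.sum_congr rfl fun x _ => ?_
      split_ifs with h
      · exact (ih x h).symm
      · rfl

end Coefficients

/-! ### Fractures of Cayley graphs -/

section PGroups

open Classical in
/-- For a `2`-group acting on a finite set, invariant sums modulo `2` are carried by the fixed
points. -/
theorem IsPGroup.sum_zmod_two_eq_sum_fixedPoints {K X : Type*} [Group K] (hK : IsPGroup 2 K)
    [Fintype X] [MulAction K X] (β : X → ZMod 2) (hβ : ∀ (k : K) x, β (k • x) = β x) :
    ∑ x, β x = ∑ x, if x ∈ MulAction.fixedPoints K X then β x else 0 := by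
  have h01 : ∀ z : ZMod 2, z = if z = 1 then 1 else 0 := by decide
  -- A function to `ZMod 2` is the indicator of the invariant set `β = 1`, so the claim is the
  -- fixed-point congruence for the cardinality of that set.
  let Y : SubMulAction K X := ⟨{x | β x = 1}, fun k x hx => (hβ k x).trans hx⟩
  have h1 : ∑ x, β x = (Nat.card Y : ZMod 2) := by
    rw [Finset.sum_congr rfl fun x _ => h01 (β x), Finset.sum_boole]
    congr 1
    change _ = Nat.card {x // β x = 1}
    rw [Nat.card_eq_fintype_card, Fintype.card_subtype]
  have h2 : (∑ x, if x ∈ MulAction.fixedPoints K X then β x else 0) =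
      (Nat.card (MulAction.fixedPoints K Y) : ZMod 2) := by
    have h3 : ∀ x, (if x ∈ MulAction.fixedPoints K X then β x else 0) =
        if β x = 1 ∧ x ∈ MulAction.fixedPoints K X then 1 else 0 := by
      intro x
      by_cases hx : x ∈ MulAction.fixedPoints K X
      · simp only [hx, if_true, and_true]
        exact h01 _
      · simp [hx]
    rw [Finset.sum_congr rfl fun x _ => h3 x, Finset.sum_boole]
    congr 1
    rw [← Fintype.card_subtype, ← Nat.card_eq_fintype_card]
    refine Nat.card_congr ⟨fun x => ⟨⟨x.1, x.2.1⟩, fun k => Subtype.ext (x.2.2 k)⟩,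
      fun y => ⟨y.1.1, y.1.2, fun k => congrArg Subtype.val (y.2 k)⟩, fun _ => rfl, fun _ => rfl⟩
  have : Fact (Nat.Prime 2) := ⟨Nat.prime_two⟩
  rw [h1, h2, ZMod.natCast_eq_natCast_iff]
  exact hK.card_modEq_card_fixedPoints Y

-- Translation preserves `β` and the condition of lying below a constant function, and its fixed
-- points are the constant functions because `K` is transitive on itself.
open Classical in
theorem IsPGroup.sum_le_const {K S : Type*} [Group K] (hK : IsPGroup 2 K)
    [Fintype (K → Setoid S)] [Fintype (Setoid S)] (β : (K → Setoid S) → ZMod 2)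
    (hβ : ∀ (k : K) f, β (fun v => f (k * v)) = β f) (τ : Setoid S) :
    (∑ f, if f ≤ Function.const K τ then β f else 0) =
      ∑ τ', if τ' ≤ τ then β (Function.const K τ') else 0 := by
  let _ : MulAction K (K → Setoid S) := arrowAction
  have hsmul : ∀ (k : K) (f : K → Setoid S), k • f = fun v => f (k⁻¹ * v) := fun _ _ => rfl
  rw [hK.sum_zmod_two_eq_sum_fixedPoints]
  · symm
    have : Nonempty K := ⟨1⟩
    refine Fintype.sum_of_injective (Function.const K) Function.const_injective _ _ ?_ ?_
    · intro f hf
      rw [if_neg]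
      intro h
      refine hf ⟨f 1, funext fun v => ?_⟩
      have h1 := congrFun (h v) v
      simp only [hsmul, inv_mul_cancel] at h1
      exact h1
    · intro τ'
      rw [if_pos (show Function.const K τ' ∈ MulAction.fixedPoints K (K → Setoid S) from
        fun k => rfl)]
      simp [Function.const_le_const]
  · intro k f
    rw [hsmul, hβ]
    refine if_congr ⟨fun h v => ?_, fun h v => h _⟩ rfl rfl
    have h1 := h (k * v)
    simp only [inv_mul_cancel_left] at h1
    exact h1

open Classical in
/-- The number of normalised two-colourings of the blocks of a partition is odd only if there is a
single block. -/
theorem sum_coarser_two_colourings {S : Type*} [Fintype S] [DecidableEq S] (s₀ : S) (τ : Setoid S) :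
    (∑ χ : S → Bool, if χ s₀ = false ∧ τ ≤ Setoid.ker χ then (1 : ZMod 2) else 0) =
      if τ = ⊤ then 1 else 0 := by
  split_ifs with hτ
  · subst hτ
    rw [Finset.sum_eq_single (fun _ => false)]
    · rw [if_pos]
      exact ⟨rfl, fun _ _ _ => rfl⟩
    · intro χ _ hχ
      rw [if_neg]
      rintro ⟨h0, h⟩
      exact hχ (funext fun s => (h (x := s) (y := s₀) trivial).trans h0)
    · simp
  · obtain ⟨s₁, hs₁⟩ : ∃ s₁, ¬ τ s₀ s₁ := by
      by_contra! h
      exact hτ (eq_top_iff.2 fun x y _ => τ.trans (τ.symm (h x)) (h y))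
    -- Reversing the colour of the block of `s₁`, which misses `s₀`, is a fixed-point-free
    -- involution on the colourings counted.
    have hflip : ∀ χ : S → Bool, (χ s₀ = false ∧ τ ≤ Setoid.ker χ) →
        (fun s => if τ s s₁ then !χ s else χ s) s₀ = false ∧
          τ ≤ Setoid.ker (fun s => if τ s s₁ then !χ s else χ s) := by
      rintro χ ⟨h0, h⟩
      refine ⟨by simp [hs₁, h0], fun x y hxy => ?_⟩
      have h1 : χ x = χ y := h hxy
      have h2 : τ x s₁ ↔ τ y s₁ := ⟨τ.trans (τ.symm hxy), τ.trans hxy⟩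
      simp [Setoid.ker_def, h1, h2]
    have hinvol : ∀ χ : S → Bool, (fun s => if τ s s₁ then
        !(if τ s s₁ then !χ s else χ s) else (if τ s s₁ then !χ s else χ s)) = χ := by
      intro χ
      funext s
      split_ifs <;> simp
    have hflip' : ∀ χ : S → Bool, ((fun s => if τ s s₁ then !χ s else χ s) s₀ = false ∧
          τ ≤ Setoid.ker (fun s => if τ s s₁ then !χ s else χ s)) →
        χ s₀ = false ∧ τ ≤ Setoid.ker χ := fun χ h => hinvol χ ▸
        hflip (fun s => if τ s s₁ then !χ s else χ s) h
    refine Finset.sum_involution (fun χ _ s => if τ s s₁ then !χ s else χ s) ?_ ?_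
      (fun _ _ => Finset.mem_univ _) (fun χ _ => hinvol χ)
    · intro χ _
      have h3 : (χ s₀ = false ∧ τ ≤ Setoid.ker χ) ↔
          ((fun s => if τ s s₁ then !χ s else χ s) s₀ = false ∧
          τ ≤ Setoid.ker (fun s => if τ s s₁ then !χ s else χ s)) :=
        ⟨hflip χ, hflip' χ⟩
      rw [if_congr h3.symm rfl rfl]
      split_ifs <;> decide
    · intro χ _ _ h
      have h1 := congrFun h s₁
      simp at h1

-- After exchanging the sums, `β τ` is weighted by the number of normalised two-colourings constant
-- on the blocks of `τ`. This takes the place of the Möbius function of the partition lattice modulo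
-- 2.
open Classical in
theorem sum_two_colourings {S : Type*} [Fintype S] [DecidableEq S] [Fintype (Setoid S)] (s₀ : S)
    (β : Setoid S → ZMod 2) :
    (∑ χ : S → Bool, if χ s₀ = false then
      (∑ τ, if τ ≤ Setoid.ker χ then β τ else 0) else 0) = β ⊤ := by
  have h1 : ∀ χ : S → Bool, (if χ s₀ = false then
      (∑ τ, if τ ≤ Setoid.ker χ then β τ else 0) else 0) =
      ∑ τ, β τ * if χ s₀ = false ∧ τ ≤ Setoid.ker χ then 1 else 0 := by
    intro χ
    by_cases h : χ s₀ = false <;> simp [h]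
  rw [Finset.sum_congr rfl fun χ _ => h1 χ, Finset.sum_comm]
  simp_rw [← Finset.mul_sum, sum_coarser_two_colourings s₀]
  simp

end PGroups

/-- A symmetric set of group elements, indexed without repetition, none of which is an
involution. -/
structure SymmetricGenerators (K S : Type) [Group K] where
  gen : S → K
  opp : S → S
  gen_opp : ∀ s, gen (opp s) = (gen s)⁻¹
  opp_ne : ∀ s, opp s ≠ s
  gen_injective : Function.Injective gen

/-! ### Homogeneous fractures of Cayley graphs -/

namespace SymmetricGenerators

variable {K S : Type} [Group K] (D : SymmetricGenerators K S)

theorem opp_opp (s : S) : D.opp (D.opp s) = s :=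
  D.gen_injective (by rw [gen_opp, gen_opp, inv_inv])

theorem gen_ne_one (s : S) : D.gen s ≠ 1 := fun h =>
  D.opp_ne s (D.gen_injective (by rw [gen_opp, h, inv_one]))

/-- The Cayley graph. -/
def cayley : SimpleGraph K where
  Adj x y := ∃ s, y = x * D.gen s
  symm := ⟨by
    rintro x _ ⟨s, rfl⟩
    exact ⟨D.opp s, by rw [gen_opp, mul_inv_cancel_right]⟩⟩
  loopless := ⟨fun x ⟨s, h⟩ => D.gen_ne_one s (by simpa using h.symm)⟩

/-- The edges at a vertex of the Cayley graph are labelled by the generators. -/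
noncomputable def label (v : K) : S ≃ D.cayley.incidenceSet v :=
  Equiv.ofBijective (fun s => ⟨s(v, v * D.gen s), ⟨s, rfl⟩, Sym2.mem_mk_left _ _⟩) (by
    constructor
    · intro s t h
      have h1 : s(v, v * D.gen s) = s(v, v * D.gen t) := congrArg Subtype.val h
      exact D.gen_injective (mul_left_cancel (Sym2.congr_right.1 h1))
    · rintro ⟨e, h, w, rfl⟩
      obtain ⟨s, rfl⟩ : ∃ s, w = v * D.gen s := h
      exact ⟨s, rfl⟩)

theorem label_val (v : K) (s : S) : (D.label v s : Sym2 K) = s(v, v * D.gen s) := rfl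

theorem label_opp_val (v : K) (s : S) :
    (D.label (v * D.gen s) (D.opp s) : Sym2 K) = s(v, v * D.gen s) := by
  rw [label_val, gen_opp, mul_inv_cancel_right, Sym2.eq_swap]

/-- Fractures of the Cayley graph in terms of generators. -/
noncomputable def fractureEquiv : Fracture D.cayley ≃o (K → Setoid S) where
  toFun ρ v := (ρ v).comap (D.label v)
  invFun f v := (f v).comap (D.label v).symm
  left_inv ρ := by
    funext v
    ext x y
    change ρ v (D.label v ((D.label v).symm x)) (D.label v ((D.label v).symm y)) ↔ ρ v x y
    rw [Equiv.apply_symm_apply, Equiv.apply_symm_apply]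
  right_inv f := by
    funext v
    ext x y
    change f v ((D.label v).symm (D.label v x)) ((D.label v).symm (D.label v y)) ↔ f v x y
    rw [Equiv.symm_apply_apply, Equiv.symm_apply_apply]
  map_rel_iff' := by
    intro ρ ρ'
    refine ⟨fun h v x y hxy => ?_, fun h v x y hxy => h v hxy⟩
    have h1 : ρ v (D.label v ((D.label v).symm x)) (D.label v ((D.label v).symm y)) →
        ρ' v (D.label v ((D.label v).symm x)) (D.label v ((D.label v).symm y)) := @h v _ _
    rw [Equiv.apply_symm_apply, Equiv.apply_symm_apply] at h1
    exact h1 hxy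

/-- The fractured graph in terms of generators. -/
def fractured (f : K → Setoid S) : SimpleGraph (Σ v : K, Quotient (f v)) where
  Adj x y := ∃ s, y.1 = x.1 * D.gen s ∧ Quotient.mk _ s = x.2 ∧ Quotient.mk _ (D.opp s) = y.2
  symm := ⟨by
    rintro x y ⟨s, h1, h2, h3⟩
    exact ⟨D.opp s, by rw [h1, gen_opp, mul_inv_cancel_right], h3, by rw [opp_opp, h2]⟩⟩
  loopless := ⟨fun x ⟨s, h, _⟩ => D.gen_ne_one s (by simpa using h.symm)⟩

/-- The edge labelled `s` at `v` carries the label `opp s` at its other end `v * gen s`. -/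
theorem nonempty_fracturedGraph_iso (ρ : Fracture D.cayley) :
    Nonempty (fracturedGraph D.cayley ρ ≃g D.fractured (D.fractureEquiv ρ)) := by
  have hq : ∀ v (x y : S), Quotient.mk (D.fractureEquiv ρ v) x = Quotient.mk _ y ↔
      Quotient.mk (ρ v) (D.label v x) = Quotient.mk _ (D.label v y) :=
    fun v x y => ⟨fun h => Quotient.sound (Quotient.exact h :),
      fun h => Quotient.sound (Quotient.exact h :)⟩
  let F : (Σ v : K, Quotient (D.fractureEquiv ρ v)) → Σ v : K, Quotient (ρ v) :=
    fun x => ⟨x.1, Quotient.lift (fun s => Quotient.mk (ρ x.1) (D.label x.1 s))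
      (fun s t h => (hq _ _ _).1 (Quotient.sound h)) x.2⟩
  have hF : Function.Bijective F := by
    constructor
    · rintro ⟨v, q⟩ ⟨w, r⟩ h
      obtain rfl : v = w := congrArg Sigma.fst h
      induction q using Quotient.inductionOn with | h s =>
      induction r using Quotient.inductionOn with | h t =>
      exact congrArg (Sigma.mk v) ((hq _ _ _).2 (eq_of_heq (Sigma.mk.inj h).2))
    · rintro ⟨v, q⟩
      induction q using Quotient.inductionOn with | h e =>
      exact ⟨⟨v, Quotient.mk _ ((D.label v).symm e)⟩,
        congrArg (Sigma.mk v) (congrArg (Quotient.mk (ρ v)) (Equiv.apply_symm_apply _ _))⟩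
  refine ⟨(RelIso.symm ⟨Equiv.ofBijective F hF, ?_⟩)⟩
  rintro ⟨v, q⟩ ⟨w, r⟩
  induction q using Quotient.inductionOn with | h s =>
  induction r using Quotient.inductionOn with | h t =>
  constructor
  · rintro ⟨hne, e, hv, hw, h1, h2⟩
    change v ≠ w at hne
    obtain ⟨u, hu⟩ : ∃ u, D.label v u = ⟨e, hv⟩ := (D.label v).surjective _
    have he : s(v, v * D.gen u) = e := congrArg Subtype.val hu
    have hwu : w = v * D.gen u := by
      rw [eq_mk_of_mem_incidenceSet hne hv hw] at he
      exact (Sym2.congr_right.1 he).symm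
    subst hwu
    have hu' : D.label _ (D.opp u) = ⟨e, hw⟩ := Subtype.ext ((D.label_opp_val v u).trans he)
    refine ⟨u, rfl, (hq _ _ _).2 ?_, (hq _ _ _).2 ?_⟩
    · exact (congrArg (Quotient.mk (ρ v)) hu).trans h1
    · exact (congrArg (Quotient.mk (ρ (v * D.gen u))) hu').trans h2
  · rintro ⟨u, h, h1, h2⟩
    change w = v * D.gen u at h
    subst h
    refine ⟨fun h : v = v * D.gen u => D.gen_ne_one u (by simpa using h.symm), s(v, v * D.gen u), (D.label v u).2,
      D.label_opp_val v u ▸ (D.label _ (D.opp u)).2, (hq _ _ _).1 h1, ?_⟩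
    have h3 := (hq _ _ _).1 h2
    refine Eq.trans (congrArg (Quotient.mk _) (Subtype.ext ?_)) h3
    exact (D.label_opp_val v u).symm

/-- Left multiplication commutes with the right multiplications that define the edges. -/
theorem nonempty_fractured_translate_iso (f : K → Setoid S) (k : K) :
    Nonempty (D.fractured (fun v => f (k * v)) ≃g D.fractured f) := by
  refine ⟨⟨Equiv.ofBijective (fun x => ⟨k * x.1, x.2⟩) ⟨?_, ?_⟩, ?_⟩⟩
  · rintro ⟨v, q⟩ ⟨w, r⟩ h
    obtain rfl : v = w := mul_left_cancel (congrArg Sigma.fst h)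
    exact congrArg (Sigma.mk v) (eq_of_heq (Sigma.mk.inj h).2)
  · rintro ⟨v, q⟩
    obtain ⟨w, rfl⟩ : ∃ w, v = k * w := ⟨k⁻¹ * v, by rw [mul_inv_cancel_left]⟩
    exact ⟨⟨w, q⟩, rfl⟩
  · rintro ⟨v, q⟩ ⟨w, r⟩
    refine exists_congr fun s => and_congr_left fun _ => ?_
    change k * w = k * v * D.gen s ↔ w = v * D.gen s
    rw [mul_assoc, mul_right_inj]

theorem _root_.Setoid.finite_setoid (S : Type*) [Finite S] : Finite (Setoid S) :=
  Finite.of_injective (fun r : Setoid S => r.r) fun _ _ h =>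
    Setoid.ext fun x y => iff_of_eq (congrFun (congrFun h x) y)

open Classical in
/-- For a Cayley graph of a `2`-group, the coefficient of `⊤` modulo `2` is the sum over the
homogeneous fractures with at most two blocks at each vertex. -/
theorem coefficient_top [Finite K] (hK : IsPGroup 2 K) [Fintype S] [DecidableEq S] (s₀ : S) (Φ : GraphProperty)
    (a : Fracture D.cayley → ℤ) (ha : IsCoefficientFunction Φ D.cayley a) :
    (a ⊤ : ZMod 2) = ∑ χ : S → Bool, if χ s₀ = false then
      ((Φ.val (D.fractured (Function.const K (Setoid.ker χ))) : ℤ) : ZMod 2) else 0 := by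
  have (S : Type) [Finite S] : Finite (Setoid S) := Setoid.finite_setoid S
  have := Fintype.ofFinite (Fracture D.cayley)
  have := Fintype.ofFinite (K → Setoid S)
  have := Fintype.ofFinite (Setoid S)
  rw [isCoefficientFunction_iff] at ha
  let β : (K → Setoid S) → ℤ := fun f => a (D.fractureEquiv.symm f)
  have hβ : ∀ f, ∑ f', (if f' ≤ f then β f' else 0) = Φ.val (D.fractured f) := by
    intro f
    have h1 := ha (D.fractureEquiv.symm f)
    have h2 : Φ.val (fracturedGraph D.cayley (D.fractureEquiv.symm f)) = Φ.val (D.fractured f) := by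
      have h3 := D.nonempty_fracturedGraph_iso (D.fractureEquiv.symm f)
      rw [OrderIso.apply_symm_apply] at h3
      exact if_congr (Φ.iso_invariant _ _ h3) rfl rfl
    rw [← h2, ← h1]
    refine (Fintype.sum_equiv D.fractureEquiv.toEquiv _ _ fun ρ => ?_).symm
    change _ = if D.fractureEquiv ρ ≤ f then a (D.fractureEquiv.symm (D.fractureEquiv ρ)) else 0
    rw [OrderIso.symm_apply_apply]
    exact if_congr D.fractureEquiv.le_symm_apply rfl rfl
  -- The translate of `β` solves the same triangular system, because translated fractures give
  -- isomorphic graphs; uniqueness applies.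
  have hinv : ∀ (k : K) f, β (fun v => f (k * v)) = β f := by
    intro k f
    refine congrFun ((existsUnique_sum_le fun f => Φ.val (D.fractured f)).unique
      (y₁ := fun f => β fun v => f (k * v)) ?_ hβ) f
    intro f
    have h1 : Φ.val (D.fractured fun v => f (k * v)) = Φ.val (D.fractured f) :=
      if_congr (Φ.iso_invariant _ _ (D.nonempty_fractured_translate_iso f k)) rfl rfl
    rw [← h1, ← hβ]
    let e : (K → Setoid S) ≃ (K → Setoid S) := (Equiv.mulLeft k).symm.arrowCongr (Equiv.refl _)
    refine Fintype.sum_equiv e _ _ fun f' => ?_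
    have he : e f' = fun v => f' (k * v) := rfl
    rw [he]
    refine if_congr ⟨fun h v => h _, fun h v => ?_⟩ rfl rfl
    have h2 := h (k⁻¹ * v)
    simpa using h2
  have h1 : ∀ τ : Setoid S, ((Φ.val (D.fractured (Function.const K τ)) : ℤ) : ZMod 2) =
      ∑ τ', if τ' ≤ τ then (β (Function.const K τ') : ZMod 2) else 0 := by
    intro τ
    rw [← hβ, ← hK.sum_le_const (fun f => (β f : ZMod 2)) (fun k f => by rw [hinv])]
    push_cast
    rfl
  simp_rw [h1]
  rw [sum_two_colourings s₀ fun τ => (β (Function.const K τ) : ZMod 2)]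
  have h2 : (Function.const K (⊤ : Setoid S)) = ⊤ := rfl
  change _ = ((a (D.fractureEquiv.symm _) : ℤ) : ZMod 2)
  rw [h2, map_top]

/-- The fractured graph for a homogeneous fracture, with the blocks at a vertex indexed by `C`. -/
def blockGraph {C : Type} (χ : S → C) : SimpleGraph (K × C) where
  Adj x y := ∃ s, y.1 = x.1 * D.gen s ∧ χ s = x.2 ∧ χ (D.opp s) = y.2
  symm := ⟨by
    rintro x y ⟨s, h1, h2, h3⟩
    exact ⟨D.opp s, by rw [h1, gen_opp, mul_inv_cancel_right], h3, by rw [opp_opp, h2]⟩⟩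
  loopless := ⟨fun x ⟨s, h, _⟩ => D.gen_ne_one s (by simpa using h.symm)⟩

theorem nonempty_blockGraph_iso {C : Type} {χ : S → C} (hχ : Function.Surjective χ) :
    Nonempty (D.fractured (Function.const K (Setoid.ker χ)) ≃g D.blockGraph χ) := by
  let e : Quotient (Setoid.ker χ) ≃ C := Setoid.quotientKerEquivOfSurjective χ hχ
  have he : ∀ s, e (Quotient.mk _ s) = χ s := fun _ => rfl
  refine ⟨⟨(Equiv.sigmaEquivProd _ _).trans ((Equiv.refl K).prodCongr e), ?_⟩⟩
  rintro ⟨v, q⟩ ⟨w, r⟩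
  refine exists_congr fun s => and_congr_right fun _ => and_congr ?_ ?_
  · rw [← he]
    exact e.apply_eq_iff_eq
  · rw [← he]
    exact e.apply_eq_iff_eq

open Classical in
theorem val_fractured_const {C V : Type} {χ : S → C} (hχ : Function.Surjective χ)
    (Φ : GraphProperty) {G : SimpleGraph V} (h : Nonempty (D.blockGraph χ ≃g G)) :
    Φ.val (D.fractured (Function.const K (Setoid.ker χ))) = Φ.val G := by
  obtain ⟨i⟩ := D.nonempty_blockGraph_iso hχ
  obtain ⟨j⟩ := h
  exact if_congr (Φ.iso_invariant _ _ ⟨i.trans j⟩) rfl rfl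

end SymmetricGenerators

/-! ### Disjoint unions of cycles and fractures of a 4-regular Cayley graph -/

/-- The graph of a permutation. -/
def permGraph {V : Type} (π : Equiv.Perm V) : SimpleGraph V where
  Adj x y := x ≠ y ∧ (y = π x ∨ x = π y)
  symm := ⟨fun _ _ h => ⟨h.1.symm, h.2.symm⟩⟩
  loopless := ⟨fun _ h => h.1 rfl⟩

theorem permGraph_adj {V : Type} {π : Equiv.Perm V} {x y : V} :
    (permGraph π).Adj x y ↔ x ≠ y ∧ (y = π x ∨ x = π y) := Iff.rfl

/-- The graph of a permutation all of whose cycles have length `n` is a disjoint union of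
cycles. -/
theorem nonempty_permGraph_iso_copies {V : Type} [Finite V] (π : Equiv.Perm V) {n : ℕ}
    (hn : 1 < n) (hπ : ∀ x, Function.minimalPeriod π x = n) :
    Nonempty (permGraph π ≃g copies (Nat.card V / n) (SimpleGraph.cycleGraph n)) := by
  obtain ⟨m, rfl⟩ : ∃ m, n = m + 1 := ⟨n - 1, by omega⟩
  let Q := Quotient (Equiv.Perm.SameCycle.setoid π)
  let f : Q × Fin (m + 1) → V := fun x => π^[x.2] x.1.out
  have hmk : ∀ x, (Quotient.mk _ (f x) : Q) = x.1 := by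
    intro x
    conv_rhs => rw [← x.1.out_eq]
    refine Quotient.sound (Equiv.Perm.SameCycle.symm ⟨(x.2 : ℕ), ?_⟩)
    rw [zpow_natCast, ← Equiv.Perm.iterate_eq_pow]
  have hf : Function.Bijective f := by
    constructor
    · rintro ⟨q, i⟩ ⟨r, j⟩ h
      obtain rfl : q = r := (hmk (q, i)).symm.trans ((congrArg _ h).trans (hmk (r, j)))
      have h1 := (Function.iterate_eq_iterate_iff_of_lt_minimalPeriod
        (by rw [hπ]; exact i.2) (by rw [hπ]; exact j.2)).1 h
      exact congrArg (Prod.mk q) (Fin.ext h1)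
    · intro x
      obtain ⟨i, hi⟩ : π.SameCycle (Quotient.mk (Equiv.Perm.SameCycle.setoid π) x).out x :=
        Quotient.exact (s := Equiv.Perm.SameCycle.setoid π) (Quotient.out_eq _)
      have hpos : (0 : ℤ) < m + 1 := by positivity
      -- The integer exponent may be reduced modulo the common cycle length.
      refine ⟨(Quotient.mk _ x, ⟨(i % (m + 1)).toNat, ?_⟩), ?_⟩
      · have := Int.emod_nonneg i hpos.ne'
        have := Int.emod_lt_of_pos i hpos
        omega
      · change π^[(i % (m + 1)).toNat]
          (Quotient.mk (Equiv.Perm.SameCycle.setoid π) x).out = x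
        have h1 : (π ^ (m + 1)) x = x := by
          rw [← Equiv.Perm.iterate_eq_pow, ← hπ x]
          exact Function.iterate_minimalPeriod
        have h2 : (π ^ ((m + 1 : ℤ) * (i / (m + 1)))) x = x := by
          rw [zpow_mul]
          refine Equiv.Perm.zpow_apply_eq_self_of_apply_eq_self ?_ _
          exact_mod_cast h1
        rw [Equiv.Perm.iterate_eq_pow, ← zpow_natCast,
          Int.toNat_of_nonneg (Int.emod_nonneg i hpos.ne'), Int.emod_def, sub_eq_neg_add, zpow_add,
          Equiv.Perm.mul_apply, hi, zpow_neg, Equiv.Perm.inv_eq_iff_eq, h2]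
  have hcard : Nat.card Q = Nat.card V / (m + 1) := by
    rw [← Nat.card_congr (Equiv.ofBijective f hf), Nat.card_prod, Nat.card_fin,
      Nat.mul_div_cancel _ m.succ_pos]
  let e : Q ≃ Fin (Nat.card V / (m + 1)) := Finite.equivFinOfCardEq hcard
  have hstep : ∀ q i, π (f (q, i)) = f (q, i + 1) := by
    intro q i
    change π (π^[i] q.out) = π^[(i + 1 : Fin (m + 1))] q.out
    rw [← Function.iterate_succ_apply' π, ← Function.iterate_mod_minimalPeriod_eq, hπ, Fin.val_add,
      Fin.val_one', Nat.add_mod_mod]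
  have hne1 : (1 : Fin (m + 1)) ≠ 0 := by
    intro h
    have := congrArg Fin.val h
    rw [Fin.val_one', Nat.mod_eq_of_lt hn] at this
    exact one_ne_zero this
  refine ⟨RelIso.symm ⟨(e.symm.prodCongr (Equiv.refl _)).trans (Equiv.ofBijective f hf), ?_⟩⟩
  rintro ⟨q, i⟩ ⟨r, j⟩
  obtain ⟨q, rfl⟩ := e.surjective q
  obtain ⟨r, rfl⟩ := e.surjective r
  have hval : ∀ q i, ((e.symm.prodCongr (Equiv.refl _)).trans (Equiv.ofBijective f hf)) (e q, i)
      = f (q, i) := by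
    intro q i
    change f (e.symm (e q), i) = _
    rw [Equiv.symm_apply_apply]
  rw [hval, hval, permGraph_adj, hstep, hstep, hf.1.ne_iff, hf.1.eq_iff, hf.1.eq_iff]
  change _ ↔ e q = e r ∧ (SimpleGraph.cycleGraph (m + 1)).Adj i j
  rw [SimpleGraph.cycleGraph_eq_circulantGraph, SimpleGraph.circulantGraph_adj]
  simp only [ne_eq, Prod.mk.injEq, Set.mem_singleton_iff, e.apply_eq_iff_eq, sub_eq_iff_eq_add']
  constructor
  · rintro ⟨h1, ⟨rfl, rfl⟩ | ⟨rfl, rfl⟩⟩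
    · exact ⟨rfl, fun h => hne1 (by simpa using h.symm), Or.inr rfl⟩
    · exact ⟨rfl, fun h => hne1 (by simpa using h), Or.inl rfl⟩
  · rintro ⟨rfl, h1, h2⟩
    refine ⟨fun h => h1 h.2, ?_⟩
    rcases h2 with h2 | h2
    · exact Or.inr ⟨rfl, h2⟩
    · exact Or.inl ⟨rfl, h2⟩

theorem minimalPeriod_eq_of_forall {α : Type*} {f : α → α} {x : α} {n : ℕ}
    (h : ∀ k, f^[k] x = x ↔ n ∣ k) : Function.minimalPeriod f x = n :=
  Nat.dvd_antisymm (Function.IsPeriodicPt.minimalPeriod_dvd ((h n).2 dvd_rfl))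
    ((h _).1 Function.iterate_minimalPeriod)

section Cycles

variable {K : Type} [Group K]

theorem minimalPeriod_mulRight (u x : K) :
    Function.minimalPeriod (Equiv.mulRight u) x = orderOf u := by
  refine minimalPeriod_eq_of_forall fun k => ?_
  rw [Equiv.coe_mulRight, mul_right_iterate, mul_eq_left, orderOf_dvd_iff_pow_eq_one]

/-- The permutation of `K × Bool` that multiplies by `u` and by `w` in turn. -/
def alternate (u w : K) : Equiv.Perm (K × Bool) where
  toFun x := (x.1 * bif x.2 then w else u, !x.2)
  invFun x := (x.1 * bif x.2 then u⁻¹ else w⁻¹, !x.2)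
  left_inv x := by rcases x with ⟨h, _ | _⟩ <;> simp
  right_inv x := by rcases x with ⟨h, _ | _⟩ <;> simp

/-- Two steps multiply by `u * w` or by its conjugate `w * u`, according to the layer; an odd number
of steps changes the layer. -/
theorem minimalPeriod_alternate (u w : K) (x : K × Bool) :
    Function.minimalPeriod (alternate u w) x = 2 * orderOf (u * w) := by
  have h2 : ∀ m (h : K) (c : Bool), (alternate u w)^[2 * m] (h, c) =
      (h * (bif c then w * u else u * w) ^ m, c) := by
    intro m h c
    induction m with
    | zero => simp
    | succ m ih =>
      rw [Nat.mul_succ, Nat.add_comm, Function.iterate_add_apply, ih]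
      cases c <;> simp [alternate, pow_succ, mul_assoc]
  have hord : orderOf (w * u) = orderOf (u * w) := by
    rw [← orderOf_injective (MulAut.conj u).toMonoidHom (MulAut.conj u).injective (w * u)]
    simp [mul_assoc]
  obtain ⟨h, c⟩ := x
  refine minimalPeriod_eq_of_forall fun k => ?_
  rcases Nat.even_or_odd' k with ⟨m, rfl | rfl⟩
  · rw [h2, Nat.mul_dvd_mul_iff_left two_pos, Prod.mk.injEq, mul_eq_left, and_iff_left rfl,
      ← orderOf_dvd_iff_pow_eq_one]
    cases c
    · rfl
    · rw [cond_true, hord]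
  · rw [Function.iterate_succ_apply', h2]
    constructor
    · intro h3
      have h4 : (!c) = c := congrArg Prod.snd h3
      simp at h4
    · intro h3
      have h4 := (Dvd.intro _ rfl).trans h3
      omega

end Cycles

namespace SymmetricGenerators

variable {K S : Type} [Group K] (D : SymmetricGenerators K S)

theorem nonempty_blockGraph_const_iso : Nonempty (D.blockGraph (fun _ => ()) ≃g D.cayley) :=
  ⟨⟨Equiv.prodPUnit K, by
    rintro ⟨x, _⟩ ⟨y, _⟩
    exact exists_congr fun s => ⟨fun h => ⟨h, rfl, rfl⟩, fun h => h.1⟩⟩⟩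

/-- Splitting off the edges labelled by a generator or by its inverse gives isomorphic graphs. -/
theorem nonempty_blockGraph_split_iso [DecidableEq S] (s₀ : S) :
    Nonempty (D.blockGraph (fun s => decide (s = s₀)) ≃g
      D.blockGraph (fun s => decide (s = D.opp s₀))) := by
  -- The vertex `(x, true)` is a leaf, attached to `x * gen s₀` on the left and to `x * (gen s₀)⁻¹`
  -- on the right, so the leaves must be shifted by the square of `gen s₀`.
  let e : K × Bool ≃ K × Bool :=
    { toFun := fun x => (x.1 * bif x.2 then D.gen s₀ * D.gen s₀ else 1, x.2)
      invFun := fun x => (x.1 * bif x.2 then (D.gen s₀)⁻¹ * (D.gen s₀)⁻¹ else 1, x.2)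
      left_inv := fun x => by rcases x with ⟨h, _ | _⟩ <;> simp [mul_assoc]
      right_inv := fun x => by rcases x with ⟨h, _ | _⟩ <;> simp [mul_assoc] }
  have hopp : ∀ s t, D.opp s = t ↔ s = D.opp t := fun s t =>
    ⟨fun h => by rw [← h, opp_opp], fun h => by rw [h, opp_opp]⟩
  refine ⟨⟨e, ?_⟩⟩
  rintro ⟨x, c⟩ ⟨y, d⟩
  change (∃ s, _ * _ = _ * _ * D.gen s ∧ decide (s = D.opp s₀) = c ∧
    decide (D.opp s = D.opp s₀) = d) ↔
    (∃ s, y = x * D.gen s ∧ decide (s = s₀) = c ∧ decide (D.opp s = s₀) = d)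
  simp only [hopp, opp_opp]
  have h1 := D.opp_ne s₀
  cases c <;> cases d <;>
    simp only [cond_true, cond_false, decide_eq_true_eq, decide_eq_false_iff_not, mul_one]
  · exact exists_congr fun s => and_congr_right fun _ => and_comm
  · constructor
    · rintro ⟨s, h, -, rfl⟩
      refine ⟨_, ?_, h1, rfl⟩
      rw [← mul_assoc, mul_left_inj] at h
      rw [gen_opp, ← h, mul_inv_cancel_right]
    · rintro ⟨s, h, -, rfl⟩
      refine ⟨s₀, ?_, h1.symm, rfl⟩
      rw [h, gen_opp]
      group
  · constructor
    · rintro ⟨s, h, rfl, -⟩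
      refine ⟨s₀, ?_, rfl, h1.symm⟩
      rw [h, gen_opp]
      group
    · rintro ⟨s, h, rfl, -⟩
      refine ⟨_, ?_, rfl, h1⟩
      rw [h, gen_opp]
      group
  · constructor
    · rintro ⟨s, -, rfl, h⟩
      exact absurd h h1
    · rintro ⟨s, -, rfl, h⟩
      exact absurd h h1.symm

end SymmetricGenerators

/-! ### The two-block fractures for four generators -/

section FourGenerators

variable {K : Type} [Group K] {a b : K}

/-- The generators `a, a⁻¹, b, b⁻¹`. -/
def fourGenerators (ha : a * a ≠ 1) (hb : b * b ≠ 1) (hab : a ≠ b) (hab' : a * b ≠ 1) :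
    SymmetricGenerators K (Fin 4) where
  gen := ![a, a⁻¹, b, b⁻¹]
  opp := ![1, 0, 3, 2]
  gen_opp s := by fin_cases s <;> simp
  opp_ne := by decide
  gen_injective := by
    have h1 : a ≠ a⁻¹ := fun h => ha (mul_eq_one_iff_eq_inv.2 h)
    have h2 : b ≠ b⁻¹ := fun h => hb (mul_eq_one_iff_eq_inv.2 h)
    have h3 : a ≠ b⁻¹ := fun h => hab' (mul_eq_one_iff_eq_inv.2 h)
    have h4 : a⁻¹ ≠ b := fun h => h3 (by rw [← h, inv_inv])
    have h5 : a⁻¹ ≠ b⁻¹ := fun h => hab (inv_injective h)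
    intro s t h
    fin_cases s <;> fin_cases t <;>
      first
      | rfl
      | exact absurd h h1
      | exact absurd h h2
      | exact absurd h h3
      | exact absurd h h4
      | exact absurd h h5
      | exact absurd h hab
      | exact absurd h.symm h1
      | exact absurd h.symm h2
      | exact absurd h.symm h3
      | exact absurd h.symm h4
      | exact absurd h.symm h5
      | exact absurd h.symm hab

variable (ha : a * a ≠ 1) (hb : b * b ≠ 1) (hab : a ≠ b) (hab' : a * b ≠ 1)

theorem fourGenerators_cayley :
    (fourGenerators ha hb hab hab').cayley = SimpleGraph.mulCayley {a, a⁻¹, b, b⁻¹} := by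
  ext x y
  rw [SimpleGraph.mulCayley_adj']
  constructor
  · intro h
    refine ⟨h.ne, ?_⟩
    obtain ⟨s, rfl⟩ := h
    refine ⟨_, ?_, Or.inl rfl⟩
    fin_cases s <;> simp [fourGenerators]
  · have key : ∀ x y, (∃ g ∈ ({a, a⁻¹, b, b⁻¹} : Set K), x * g = y) →
        (fourGenerators ha hb hab hab').cayley.Adj x y := by
      rintro x _ ⟨g, rfl | rfl | rfl | rfl, rfl⟩
      exacts [⟨0, rfl⟩, ⟨1, rfl⟩, ⟨2, rfl⟩, ⟨3, rfl⟩]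
    rintro ⟨-, g, hg, h | h⟩
    · exact key _ _ ⟨g, hg, h⟩
    · exact (key _ _ ⟨g, hg, h.symm⟩).symm

theorem blockGraph_fourGenerators_adj {C : Type} (χ : Fin 4 → C) (x y : K × C) :
    ((fourGenerators ha hb hab hab').blockGraph χ).Adj x y ↔
      (y.1 = x.1 * a ∧ χ 0 = x.2 ∧ χ 1 = y.2) ∨ (y.1 = x.1 * a⁻¹ ∧ χ 1 = x.2 ∧ χ 0 = y.2) ∨
      (y.1 = x.1 * b ∧ χ 2 = x.2 ∧ χ 3 = y.2) ∨ (y.1 = x.1 * b⁻¹ ∧ χ 3 = x.2 ∧ χ 2 = y.2) := by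
  change (∃ s : Fin 4, _) ↔ _
  simp only [Fin.exists_fin_succ, IsEmpty.exists_iff, or_false]
  rfl

/-- The blocks are `{a, b}` and `{a⁻¹, b⁻¹}`: an edge left along `a` arrives in the second block,
whose other label is `b⁻¹`. -/
theorem nonempty_blockGraph_iso_alternate :
    Nonempty ((fourGenerators ha hb hab hab').blockGraph ![true, false, true, false] ≃g
      permGraph (alternate b⁻¹ a)) := by
  refine ⟨⟨Equiv.refl _, ?_⟩⟩
  rintro ⟨x, c⟩ ⟨y, d⟩
  rw [blockGraph_fourGenerators_adj, permGraph_adj]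
  cases c <;> cases d <;> simp [alternate, eq_mul_inv_iff_mul_eq, eq_comm, or_comm]

/-- The blocks are `{a⁻¹, b}` and `{a, b⁻¹}`: after a step along `a` the walk continues along `b`.
-/
theorem nonempty_blockGraph_iso_alternate' :
    Nonempty ((fourGenerators ha hb hab hab').blockGraph ![false, true, true, false] ≃g
      permGraph (alternate a b)) := by
  refine ⟨⟨Equiv.refl _, ?_⟩⟩
  rintro ⟨x, c⟩ ⟨y, d⟩
  rw [blockGraph_fourGenerators_adj, permGraph_adj]
  cases c <;> cases d <;> simp [alternate, eq_mul_inv_iff_mul_eq, eq_comm, or_comm]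

/-- With blocks `{a, a⁻¹}` and `{b, b⁻¹}` every edge stays within its layer. -/
theorem nonempty_blockGraph_iso_sum :
    Nonempty ((fourGenerators ha hb hab hab').blockGraph ![true, true, false, false] ≃g
      (permGraph (Equiv.mulRight a)).sum (permGraph (Equiv.mulRight b))) := by
  have ha1 : a ≠ 1 := fun h => ha (by rw [h, mul_one])
  have hb1 : b ≠ 1 := fun h => hb (by rw [h, mul_one])
  let e : K × Bool ≃ K ⊕ K :=
    { toFun := fun x => bif x.2 then Sum.inl x.1 else Sum.inr x.1
      invFun := Sum.elim (fun x => (x, true)) (fun x => (x, false))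
      left_inv := fun x => by rcases x with ⟨h, _ | _⟩ <;> simp
      right_inv := fun x => by rcases x with h | h <;> simp }
  refine ⟨⟨e, ?_⟩⟩
  rintro ⟨x, c⟩ ⟨y, d⟩
  rw [blockGraph_fourGenerators_adj]
  have key : ∀ u : K, u ≠ 1 → ((permGraph (Equiv.mulRight u)).Adj x y ↔
      y = x * u ∨ y = x * u⁻¹) := by
    intro u hu
    rw [permGraph_adj, Equiv.coe_mulRight, eq_mul_inv_iff_mul_eq, and_iff_right_of_imp]
    · exact or_congr Iff.rfl eq_comm
    · rintro (h | h) rfl <;> exact hu (by simpa using h.symm)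
  cases c <;> cases d
  · refine (key b hb1).trans ?_
    simp
  · simp [e]
  · simp [e]
  · refine (key a ha1).trans ?_
    simp

/-- The coefficient of `⊤` modulo `2` for a `4`-regular Cayley graph of a `2`-group. -/
theorem coefficient_top_fourGenerators [Finite K] (hK : IsPGroup 2 K) (ha : a * a ≠ 1)
    (hb : b * b ≠ 1) (hab : a ≠ b) (hab' : a * b ≠ 1) (Φ : GraphProperty)
    (coeff : Fracture (SimpleGraph.mulCayley {a, a⁻¹, b, b⁻¹}) → ℤ)
    (hcoeff : IsCoefficientFunction Φ (SimpleGraph.mulCayley {a, a⁻¹, b, b⁻¹}) coeff) :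
    coeff ⊤ ≡
      Φ.val ((copies (Nat.card K / orderOf a) (SimpleGraph.cycleGraph (orderOf a))).sum
          (copies (Nat.card K / orderOf b) (SimpleGraph.cycleGraph (orderOf b))))
        + Φ.val (copies (Nat.card K / orderOf (b⁻¹ * a))
            (SimpleGraph.cycleGraph (2 * orderOf (b⁻¹ * a))))
        + Φ.val (copies (Nat.card K / orderOf (b * a))
            (SimpleGraph.cycleGraph (2 * orderOf (b * a))))
        + Φ.val (SimpleGraph.mulCayley {a, a⁻¹, b, b⁻¹}) [ZMOD 2] := by
  have hΓ := fourGenerators_cayley ha hb hab hab'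
  set D := fourGenerators ha hb hab hab' with hD
  revert coeff
  rw [← hΓ]
  intro coeff hcoeff
  have hord1 : ∀ u : K, u ≠ 1 → 1 < orderOf u := fun u hu => by
    have h1 := orderOf_pos u
    have h2 := mt orderOf_eq_one_iff.1 hu
    omega
  have hcycle : ∀ u : K, u ≠ 1 → Nonempty (permGraph (Equiv.mulRight u) ≃g
      copies (Nat.card K / orderOf u) (SimpleGraph.cycleGraph (orderOf u))) := fun u hu =>
    nonempty_permGraph_iso_copies _ (hord1 u hu) (minimalPeriod_mulRight u)
  have hcycle2 : ∀ u w z : K, orderOf (u * w) = orderOf z → Nonempty (permGraph (alternate u w) ≃g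
      copies (Nat.card K / orderOf z) (SimpleGraph.cycleGraph (2 * orderOf z))) := by
    intro u w z hz
    have h1 := orderOf_pos (u * w)
    have h2 := nonempty_permGraph_iso_copies (alternate u w) (by omega)
      (minimalPeriod_alternate u w)
    rwa [Nat.card_prod, Nat.card_eq_fintype_card (α := Bool), Fintype.card_bool, mul_comm,
      Nat.mul_div_mul_left _ _ two_pos, hz] at h2
  have ha1 : a ≠ 1 := fun h => ha (by rw [h, mul_one])
  have hb1 : b ≠ 1 := fun h => hb (by rw [h, mul_one])
  have hcomm : orderOf (a * b) = orderOf (b * a) := by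
    rw [← orderOf_injective (MulAut.conj b).toMonoidHom (MulAut.conj b).injective (a * b)]
    simp [mul_assoc]
  obtain ⟨ia⟩ := hcycle a ha1
  obtain ⟨ib⟩ := hcycle b hb1
  obtain ⟨i0⟩ := nonempty_blockGraph_iso_sum ha hb hab hab'
  obtain ⟨i2⟩ := hcycle2 b⁻¹ a _ rfl
  obtain ⟨i3⟩ := hcycle2 a b _ hcomm
  obtain ⟨j2⟩ := nonempty_blockGraph_iso_alternate ha hb hab hab'
  obtain ⟨j3⟩ := nonempty_blockGraph_iso_alternate' ha hb hab hab'
  have e0 := D.val_fractured_const (by decide) Φ ⟨i0.trans (SimpleGraph.Iso.sumCongr ia ib)⟩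
  have e2 := D.val_fractured_const (by decide) Φ ⟨j2.trans i2⟩
  have e3 := D.val_fractured_const (by decide) Φ ⟨j3.trans i3⟩
  have eΓ := D.val_fractured_const (by decide) Φ D.nonempty_blockGraph_const_iso
  have es : ∀ s : Fin 4,
      Φ.val (D.fractured (Function.const K (Setoid.ker fun t => decide (t = s)))) =
      Φ.val (D.fractured (Function.const K (Setoid.ker fun t => decide (t = D.opp s)))) := by
    intro s
    have hsurj : ∀ s : Fin 4, Function.Surjective fun t => decide (t = s) := by decide
    obtain ⟨i⟩ := D.nonempty_blockGraph_iso (hsurj (D.opp s))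
    obtain ⟨j⟩ := D.nonempty_blockGraph_split_iso s
    exact D.val_fractured_const (hsurj s) Φ ⟨j.trans i.symm⟩
  have hker : ∀ (C C' : Type) (χ : Fin 4 → C) (χ' : Fin 4 → C'),
      (∀ s t, χ s = χ t ↔ χ' s = χ' t) → Setoid.ker χ = Setoid.ker χ' :=
    fun _ _ _ _ h => Setoid.ext h
  have es0 := es 0
  have es2 := es 2
  have o0 : D.opp 0 = 1 := rfl
  have o2 : D.opp 2 = 3 := rfl
  rw [o0] at es0
  rw [o2] at es2
  rw [hker _ _ (fun t : Fin 4 => decide (t = 0)) ![true, false, false, false] (by decide),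
    hker _ _ (fun t : Fin 4 => decide (t = 1)) ![false, true, false, false] (by decide)] at es0
  -- Colourings are normalised to be `false` at index 3, so the block `{3}` is represented by the
  -- complementary colouring.
  rw [hker _ _ (fun t : Fin 4 => decide (t = 2)) ![false, false, true, false] (by decide),
    hker _ _ (fun t : Fin 4 => decide (t = 3)) ![true, true, true, false] (by decide)] at es2
  rw [hker _ _ (fun _ : Fin 4 => ()) ![false, false, false, false] (by decide)] at eΓ
  have hmain := D.coefficient_top hK 3 Φ coeff hcoeff
  have huniv : (Finset.univ.filter fun χ : Fin 4 → Bool => χ 3 = false) =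
      {![false, false, false, false], ![true, true, false, false], ![true, false, true, false],
        ![false, true, true, false], ![true, false, false, false], ![false, true, false, false],
        ![false, false, true, false], ![true, true, true, false]} := by decide
  rw [← Finset.sum_filter, huniv] at hmain
  repeat rw [Finset.sum_insert (by decide)] at hmain
  rw [Finset.sum_singleton, e0, e2, e3, eΓ, es0, es2] at hmain
  -- The four fractures splitting off a single generator form two pairs of equal values and vanish
  -- modulo 2.
  have h2 : ∀ z : ZMod 2, z + z = 0 := by decide
  refine (ZMod.intCast_eq_intCast_iff _ _ 2).1 ?_
  rw [hmain]
  push_cast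
  linear_combination h2 ((Φ.val (D.fractured (Function.const K (Setoid.ker
    ![false, true, false, false]))) : ℤ) : ZMod 2) + h2 ((Φ.val (D.fractured (Function.const K
    (Setoid.ker ![true, true, true, false]))) : ℤ) : ZMod 2)

end FourGenerators

/-! ### The quotients of the group of Peyerimhoff and Vdovina -/

namespace PV

/-- Columns of two elements of `𝔽₈`, i.e. of two vectors in `𝔽₂³`. -/
abbrev Column : Type := ZMod 2 × ZMod 2 × ZMod 2 × ZMod 2 × ZMod 2 × ZMod 2

/-- The action of `1 + τ` modulo `τ³`. -/
def perm₀ : Equiv.Perm Column where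
  toFun | (a, b, c, d, e, f) => (a + 1, b, c, d + a, e + b, f + c)
  invFun | (a, b, c, d, e, f) => (a + 1, b, c, d + (a + 1), e + b, f + c)
  left_inv := by decide +kernel
  right_inv := by decide +kernel

/-- The action of `1 + g τ` modulo `τ³`. -/
def perm₁ : Equiv.Perm Column where
  toFun | (a, b, c, d, e, f) => (a, b, c + 1, d + c, e + (a + c), f + b)
  invFun | (a, b, c, d, e, f) => (a, b, c + 1, d + (c + 1), e + (a + (c + 1)), f + b)
  left_inv := by decide +kernel
  right_inv := by decide +kernel

/-- The permutation representation of the free group. -/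
def permRepFree : FreeGroup (Fin 2) →* Equiv.Perm Column := FreeGroup.lift ![perm₀, perm₁]

theorem permRepFree_x_zero : permRepFree (x 0) = perm₀ := FreeGroup.lift_apply_of

theorem permRepFree_x_one : permRepFree (x 1) = perm₁ := FreeGroup.lift_apply_of

/-- The central units are trivial modulo `τ³`, so the relators should act as the identity; this is
checked on all 64 columns. -/
theorem permRepFree_relators : ∀ r ∈ relators, permRepFree r = 1 := by
  rintro r (rfl | rfl | rfl)
  all_goals
    simp only [map_mul, map_inv, map_pow, permRepFree_x_zero, permRepFree_x_one]
    refine Equiv.ext ?_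
    decide +kernel

/-- The permutation representation of `PVGroup`. -/
def permRep : PVGroup →* Equiv.Perm Column := PresentedGroup.toGroup permRepFree_relators

theorem permRep_mk (w : FreeGroup (Fin 2)) :
    permRep (PresentedGroup.mk relators w) = permRepFree w := rfl

/-- The matrix column with entries in `M3` corresponding to an element of `Column`. -/
def columnMatrix : Column → Matrix (Fin 3) (Fin 1) M3
  | (a, b, c, d, e, f) => Matrix.of fun i _ =>
    ![!![d, 0, 0; e, 0, 0; f, 0, 0], !![a, 0, 0; b, 0, 0; c, 0, 0], !![1, 0, 0; 0, 0, 0; 0, 0, 0]] i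

theorem columnMatrix_injective : Function.Injective columnMatrix := by
  rintro ⟨a, b, c, d, e, f⟩ ⟨a', b', c', d', e', f'⟩ h
  have h0 := congrFun (congrFun h 0) 0
  have h1 := congrFun (congrFun h 1) 0
  have k0 : d = d' := congrFun (congrFun h0 0) 0
  have k1 : e = e' := congrFun (congrFun h0 1) 0
  have k2 : f = f' := congrFun (congrFun h0 2) 0
  have k3 : a = a' := congrFun (congrFun h1 0) 0
  have k4 : b = b' := congrFun (congrFun h1 1) 0
  have k5 : c = c' := congrFun (congrFun h1 2) 0
  rw [k0, k1, k2, k3, k4, k5]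

theorem val_unip (n : ℕ) (u : M3) : (unip n u : Mat n) = 1 + upper n u := rfl

theorem rep_x_zero (n : ℕ) : rep n (x 0) = unip n 1 := FreeGroup.lift_apply_of

theorem rep_x_one (n : ℕ) : rep n (x 1) = unip n g := FreeGroup.lift_apply_of

/-- With `e` the first basis vector, `1 + u τ` sends the block column `(y₀, y₁, 1)` to `(y₀ + u y₁,
y₁ + u² e, 1)`, an affine map of the six free coordinates. -/
theorem unip_mul_columnMatrix (y : Column) :
    (unip 3 1 : Mat 3) * columnMatrix y = columnMatrix (perm₀ y) ∧
      (unip 3 g : Mat 3) * columnMatrix y = columnMatrix (perm₁ y) := by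
  rw [val_unip, val_unip]
  revert y
  decide +kernel

theorem rep_mul_columnMatrix (w : FreeGroup (Fin 2)) :
    ∀ y, ((rep 3 w : (Mat 3)ˣ) : Mat 3) * columnMatrix y = columnMatrix (permRepFree w y) := by
  have hof : ∀ (i : Fin 2) y, ((rep 3 (FreeGroup.of i) : (Mat 3)ˣ) : Mat 3) * columnMatrix y =
      columnMatrix (permRepFree (FreeGroup.of i) y) := by
    intro i y
    match i with
    | 0 =>
      change ((rep 3 (x 0) : (Mat 3)ˣ) : Mat 3) * _ = columnMatrix (permRepFree (x 0) y)
      rw [rep_x_zero, permRepFree_x_zero, (unip_mul_columnMatrix y).1]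
    | 1 =>
      change ((rep 3 (x 1) : (Mat 3)ˣ) : Mat 3) * _ = columnMatrix (permRepFree (x 1) y)
      rw [rep_x_one, permRepFree_x_one, (unip_mul_columnMatrix y).2]
  refine FreeGroup.induction_on (C := fun w => ∀ y, ((rep 3 w : (Mat 3)ˣ) : Mat 3) *
    columnMatrix y = columnMatrix (permRepFree w y)) w ?_ hof ?_ ?_
  · intro y
    simp
  · intro i h y
    have h1 := h (permRepFree (FreeGroup.of i)⁻¹ y)
    rw [map_inv, Equiv.Perm.inv_def, Equiv.apply_symm_apply] at h1
    rw [map_inv, ← h1, ← Matrix.mul_assoc, Units.inv_mul, Matrix.one_mul, map_inv]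
    rfl
  · intro v w hv hw y
    rw [map_mul, Units.val_mul, Matrix.mul_assoc, hw, hv, map_mul]
    rfl

/-- Here `τ³ = 0`, so the central subring is `𝔽₂`, whose only unit is 1. -/
theorem rep_eq_one_of_mem_centralWords {w : FreeGroup (Fin 2)} (hw : w ∈ centralWords 3) :
    rep 3 w = 1 := by
  have h1 : ((rep 3 w : (Mat 3)ˣ) : Mat 3) ∈ Algebra.adjoin (ZMod 2) {tauCubed 3} := hw
  have h2 : tauCubed 3 = 0 := by
    ext1 j k
    have : ¬ (j : ℕ) + 3 = k := by omega
    simp [tauCubed, this]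
  rw [h2, Algebra.adjoin_singleton_zero, Algebra.mem_bot] at h1
  obtain ⟨r, hr⟩ := h1
  have h01 : ∀ r : ZMod 2, r = 0 ∨ r = 1 := by decide
  rcases h01 r with rfl | rfl
  · rw [map_zero] at hr
    exact absurd hr.symm (Units.ne_zero _)
  · rw [map_one] at hr
    exact Units.ext hr.symm

theorem N_two_le_ker : N 2 ≤ permRep.ker := by
  rintro _ ⟨w, hw, rfl⟩
  rw [MonoidHom.mem_ker, permRep_mk]
  refine Equiv.ext fun y => columnMatrix_injective ?_
  rw [← rep_mul_columnMatrix, rep_eq_one_of_mem_centralWords hw, Units.val_one, Matrix.one_mul]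
  rfl

/-! ### Truncation from `τⁿ` to `τ³` -/

/-- The inclusion of the first three coordinates. -/
def inclusion (n : ℕ) : Matrix (Fin n) (Fin 3) M3 :=
  Matrix.of fun j k => if (j : ℕ) = k then 1 else 0

theorem mul_inclusion_apply {n : ℕ} (hn : 3 ≤ n) (A : Mat n) (j : Fin n) (k : Fin 3) :
    (A * inclusion n) j k = A j ⟨k, by omega⟩ := by
  rw [Matrix.mul_apply, Finset.sum_eq_single ⟨k, by omega⟩]
  · simp [inclusion]
  · intro l _ hl
    have : ¬ (l : ℕ) = k := fun h => hl (Fin.ext h)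
    simp [inclusion, this]
  · simp

theorem inclusion_mul_apply {n : ℕ} (B : Mat 3) (j : Fin n) (k : Fin 3) :
    (inclusion n * B) j k = if h : (j : ℕ) < 3 then B ⟨j, h⟩ k else 0 := by
  rw [Matrix.mul_apply]
  split_ifs with h
  · rw [Finset.sum_eq_single ⟨j, h⟩]
    · simp [inclusion]
    · intro l _ hl
      have : ¬ (j : ℕ) = l := fun h => hl (Fin.ext h.symm)
      simp [inclusion, this]
    · simp
  · refine Finset.sum_eq_zero fun l _ => ?_
    have : ¬ (j : ℕ) = l := by omega
    simp [inclusion, this]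

theorem inclusion_mul_injective {n : ℕ} (hn : 3 ≤ n) {B C : Mat 3}
    (h : inclusion n * B = inclusion n * C) : B = C := by
  ext1 j k
  have h1 := congrFun (congrFun h ⟨j, by omega⟩) k
  rw [inclusion_mul_apply, inclusion_mul_apply] at h1
  simpa using h1

theorem upper_mul_inclusion {n : ℕ} (hn : 3 ≤ n) (u : M3) :
    upper n u * inclusion n = inclusion n * upper 3 u := by
  ext1 j k
  rw [mul_inclusion_apply hn, inclusion_mul_apply]
  have := k.2
  split_ifs with h
  · simp [upper]
  · have : ¬ (j : ℕ) + 1 = k := by omega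
    simp [upper, this]

theorem tauCubed_mul_inclusion {n : ℕ} (hn : 3 ≤ n) :
    tauCubed n * inclusion n = inclusion n * tauCubed 3 := by
  ext1 j k
  rw [mul_inclusion_apply hn, inclusion_mul_apply]
  have := k.2
  split_ifs with h
  · simp [tauCubed]
  · have : ¬ (j : ℕ) + 3 = k := by omega
    simp [tauCubed, this]

/-- The span of the first three coordinates is invariant under upper triangular matrices, and
restriction to it is truncation modulo `τ³`. -/
theorem rep_mul_inclusion {n : ℕ} (hn : 3 ≤ n) (w : FreeGroup (Fin 2)) :
    ((rep n w : (Mat n)ˣ) : Mat n) * inclusion n =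
      inclusion n * ((rep 3 w : (Mat 3)ˣ) : Mat 3) := by
  have hunip : ∀ u, (unip n u : Mat n) * inclusion n = inclusion n * (unip 3 u : Mat 3) := by
    intro u
    rw [val_unip, val_unip, Matrix.add_mul, Matrix.mul_add, upper_mul_inclusion hn, Matrix.one_mul,
      Matrix.mul_one]
  have hof : ∀ i : Fin 2, ((rep n (FreeGroup.of i) : (Mat n)ˣ) : Mat n) * inclusion n =
      inclusion n * ((rep 3 (FreeGroup.of i) : (Mat 3)ˣ) : Mat 3) := by
    intro i
    match i with
    | 0 =>
      change ((rep n (x 0) : (Mat n)ˣ) : Mat n) * _ = _ * ((rep 3 (x 0) : (Mat 3)ˣ) : Mat 3)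
      rw [rep_x_zero, rep_x_zero, hunip]
    | 1 =>
      change ((rep n (x 1) : (Mat n)ˣ) : Mat n) * _ = _ * ((rep 3 (x 1) : (Mat 3)ˣ) : Mat 3)
      rw [rep_x_one, rep_x_one, hunip]
  refine FreeGroup.induction_on (C := fun w => ((rep n w : (Mat n)ˣ) : Mat n) * inclusion n =
      inclusion n * ((rep 3 w : (Mat 3)ˣ) : Mat 3)) w ?_ hof ?_ ?_
  · rw [map_one, map_one, Units.val_one, Units.val_one, Matrix.one_mul, Matrix.mul_one]
  · intro i h
    rw [map_inv, map_inv]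
    calc _ = ((rep n (FreeGroup.of i))⁻¹ : (Mat n)ˣ).1 * (inclusion n *
          ((rep 3 (FreeGroup.of i) : (Mat 3)ˣ) : Mat 3)) * ((rep 3 (FreeGroup.of i))⁻¹ : (Mat 3)ˣ).1 := by
          rw [← Matrix.mul_assoc, Matrix.mul_assoc _ _ (((rep 3 (FreeGroup.of i))⁻¹ : (Mat 3)ˣ).1),
            Units.mul_inv, Matrix.mul_one]
      _ = _ := by
          rw [← h, ← Matrix.mul_assoc, Units.inv_mul, Matrix.one_mul]
  · intro v w hv hw
    rw [map_mul, map_mul, Units.val_mul, Units.val_mul, Matrix.mul_assoc, hw, ← Matrix.mul_assoc,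
      hv, Matrix.mul_assoc]

/-- The inclusion intertwines each polynomial in `τ³` with one of size 3, and can be cancelled on
the left. -/
theorem centralWords_le {n : ℕ} (hn : 3 ≤ n) : centralWords n ≤ centralWords 3 := by
  intro w hw
  have key : ∀ c ∈ Algebra.adjoin (ZMod 2) {tauCubed n},
      ∃ c' ∈ Algebra.adjoin (ZMod 2) {tauCubed 3}, c * inclusion n = inclusion n * c' := by
    intro c hc
    induction hc using Algebra.adjoin_induction with
    | mem y hy =>
      rw [Set.mem_singleton_iff.1 hy]
      exact ⟨_, Algebra.self_mem_adjoin_singleton _ _, tauCubed_mul_inclusion hn⟩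
    | algebraMap r =>
      have h01 : ∀ r : ZMod 2, r = 0 ∨ r = 1 := by decide
      rcases h01 r with rfl | rfl
      · exact ⟨0, zero_mem _, by rw [map_zero, Matrix.zero_mul, Matrix.mul_zero]⟩
      · exact ⟨1, one_mem _, by rw [map_one, Matrix.one_mul, Matrix.mul_one]⟩
    | add y z _ _ hy hz =>
      obtain ⟨y', hy', hy⟩ := hy
      obtain ⟨z', hz', hz⟩ := hz
      exact ⟨y' + z', add_mem hy' hz', by rw [Matrix.add_mul, Matrix.mul_add, hy, hz]⟩
    | mul y z _ _ hy hz =>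
      obtain ⟨y', hy', hy⟩ := hy
      obtain ⟨z', hz', hz⟩ := hz
      exact ⟨y' * z', mul_mem hy' hz', by
        rw [Matrix.mul_assoc, hz, ← Matrix.mul_assoc, hy, Matrix.mul_assoc]⟩
  obtain ⟨c', hc', h⟩ := key _ hw
  rw [rep_mul_inclusion hn] at h
  change ((rep 3 w : (Mat 3)ˣ) : Mat 3) ∈ Algebra.adjoin (ZMod 2) {tauCubed 3}
  rwa [inclusion_mul_injective hn h]

theorem N_le_N_two {i : ℕ} (hi : 2 ≤ i) : N i ≤ N 2 :=
  Subgroup.map_mono (centralWords_le (by omega))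

/-! ### The quotients by the tower are 2-groups -/

/-- The units that are upper triangular with ones on the diagonal. -/
def unitriangular (n : ℕ) : Submonoid (Mat n)ˣ where
  carrier := {A | ∀ j k : Fin n, k ≤ j → (A : Mat n) j k = (1 : Mat n) j k}
  one_mem' _ _ _ := rfl
  mul_mem' := by
    intro A B hA hB j k hkj
    rw [Units.val_mul, Matrix.mul_apply, ← Matrix.one_mul (1 : Mat n), Matrix.mul_apply]
    refine Finset.sum_congr rfl fun l _ => ?_
    rcases le_or_gt l j with hlj | hlj
    · rw [hA j l hlj]
      rcases eq_or_ne j l with rfl | hne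
      · rw [hB j k hkj]
      · rw [Matrix.one_apply_ne hne, zero_mul, zero_mul]
    · rw [hB l k (hkj.trans hlj.le), Matrix.one_apply_ne (hkj.trans_lt hlj).ne', mul_zero, mul_zero]

theorem finite_mat (n : ℕ) : Finite (Mat n) :=
  inferInstanceAs (Finite (Fin n → Fin n → Fin 3 → Fin 3 → ZMod 2))

theorem rep_mem_unitriangular (n : ℕ) (w : FreeGroup (Fin 2)) : rep n w ∈ unitriangular n := by
  have := finite_mat n
  have hunip : ∀ u, unip n u ∈ unitriangular n := by
    intro u j k hkj
    have : ¬ (j : ℕ) + 1 = k := by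
      have : (k : ℕ) ≤ j := hkj
      omega
    rw [val_unip, Matrix.add_apply]
    simp [upper, this]
  have hof : ∀ i : Fin 2, rep n (FreeGroup.of i) ∈ unitriangular n := by
    intro i
    match i with
    | 0 => exact rep_x_zero n ▸ hunip 1
    | 1 => exact rep_x_one n ▸ hunip g
  refine FreeGroup.induction_on (C := fun w => rep n w ∈ unitriangular n) w ?_ hof ?_ ?_
  · rw [map_one]
    exact one_mem _
  · intro i h
    -- In a finite group an inverse is a power, so a submonoid suffices.
    have h1 : (rep n (FreeGroup.of i))⁻¹ =
        rep n (FreeGroup.of i) ^ (orderOf (rep n (FreeGroup.of i)) - 1) := by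
      rw [inv_eq_iff_mul_eq_one, ← pow_succ', Nat.sub_add_cancel (orderOf_pos _), pow_orderOf_eq_one]
    rw [map_inv, h1]
    exact pow_mem h _
  · intro v w hv hw
    rw [map_mul]
    exact mul_mem hv hw

/-- In characteristic 2, `(1 + X)^(2^n) = 1 + X^(2^n)`, and `X` is strictly upper triangular with `n
< 2^n`. -/
theorem pow_eq_one_of_mem_unitriangular {n : ℕ} [NeZero n] {A : (Mat n)ˣ}
    (hA : A ∈ unitriangular n) : A ^ 2 ^ n = 1 := by
  obtain ⟨X, hX⟩ : ∃ X : Mat n, (A : Mat n) = 1 + X := ⟨A - 1, by abel⟩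
  have h0 : ∀ j k : Fin n, (k : ℕ) < j + 1 → X j k = 0 := by
    intro j k hjk
    have h1 := hA j k (Nat.lt_succ_iff.1 hjk)
    rw [hX, Matrix.add_apply] at h1
    exact left_eq_add.1 h1.symm
  have hpow : ∀ (m : ℕ) (j k : Fin n), (k : ℕ) < j + m → (X ^ m) j k = 0 := by
    intro m
    induction m with
    | zero =>
      intro j k h
      rw [pow_zero, Matrix.one_apply_ne]
      rintro rfl
      omega
    | succ m ih =>
      intro j k h
      rw [pow_succ, Matrix.mul_apply]
      refine Finset.sum_eq_zero fun l _ => ?_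
      rcases lt_or_ge (l : ℕ) (j + m) with hl | hl
      · rw [ih j l hl, zero_mul]
      · rw [h0 l k (by omega), mul_zero]
  have hzero : X ^ 2 ^ n = 0 := by
    ext1 j k
    have h1 := k.2
    have h2 : n < 2 ^ n := Nat.lt_two_pow_self
    rw [hpow _ _ _ (by omega)]
    rfl
  have : Fact (Nat.Prime 2) := ⟨Nat.prime_two⟩
  refine Units.ext ?_
  rw [Units.val_pow_eq_pow_val, hX, add_pow_char_pow_of_commute (p := 2) _ (Commute.one_left X),
    one_pow, hzero, add_zero, Units.val_one]

/-- The quotients by the subgroups of the tower are finite `2`-groups. -/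
theorem index_N (i : ℕ) : ∃ t : ℕ, (N i).index = 2 ^ t := by
  have := finite_mat (i + 1)
  have hp : IsPGroup 2 (PVGroup ⧸ N i) := by
    intro q
    obtain ⟨h, rfl⟩ := QuotientGroup.mk_surjective q
    obtain ⟨w, rfl⟩ := PresentedGroup.mk_surjective relators h
    refine ⟨i + 1, ?_⟩
    rw [← QuotientGroup.mk_pow, QuotientGroup.eq_one_iff, ← map_pow]
    refine Subgroup.mem_map_of_mem _ ?_
    change ((rep (i + 1) _ : (Mat (i + 1))ˣ) : Mat (i + 1)) ∈
      Algebra.adjoin (ZMod 2) {tauCubed (i + 1)}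
    rw [map_pow, pow_eq_one_of_mem_unitriangular (rep_mem_unitriangular _ w)]
    exact one_mem _
  have hker : (rep (i + 1)).ker ≤ centralWords (i + 1) := by
    intro w hw
    change ((rep (i + 1) w : (Mat (i + 1))ˣ) : Mat (i + 1)) ∈
      Algebra.adjoin (ZMod 2) {tauCubed (i + 1)}
    rw [MonoidHom.mem_ker.1 hw]
    exact one_mem _
  have : (rep (i + 1)).ker.FiniteIndex := inferInstance
  have : (centralWords (i + 1)).FiniteIndex := Subgroup.finiteIndex_of_le hker
  have h1 : (N i).FiniteIndex := ⟨fun h => Subgroup.FiniteIndex.index_ne_zero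
    (Nat.eq_zero_of_zero_dvd (h ▸ Subgroup.index_map_dvd (centralWords (i + 1))
      (PresentedGroup.mk_surjective relators)))⟩
  have : Finite (PVGroup ⧸ N i) := Subgroup.finite_quotient_of_finiteIndex
  exact IsPGroup.iff_card.1 hp

theorem permRep_of_zero : permRep (PresentedGroup.of 0) = perm₀ := permRepFree_x_zero

theorem permRep_of_one : permRep (PresentedGroup.of 1) = perm₁ := permRepFree_x_one

/-- The 32 products `x₀^i x₁^j (x₁x₀)^(2k)` with `i, j < 4` and `k < 2` move the zero column to
different places. -/
theorem le_card_range_permRep : 32 ≤ Nat.card permRep.range := by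
  let φ : Fin 4 × Fin 4 × Fin 2 → permRep.range := fun i =>
    permRep.rangeRestrict (PresentedGroup.of 0 ^ (i.1 : ℕ) * PresentedGroup.of 1 ^ (i.2.1 : ℕ) *
      (PresentedGroup.of 1 * PresentedGroup.of 0) ^ (2 * (i.2.2 : ℕ)))
  have hinj : Function.Injective fun i : Fin 4 × Fin 4 × Fin 2 =>
      (perm₀ ^ (i.1 : ℕ) * perm₁ ^ (i.2.1 : ℕ) * (perm₁ * perm₀) ^ (2 * (i.2.2 : ℕ))) 0 := by
    decide +kernel
  have hφ : Function.Injective φ := by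
    intro i j h
    have hval : ∀ i, (φ i : Equiv.Perm Column) = perm₀ ^ (i.1 : ℕ) * perm₁ ^ (i.2.1 : ℕ) *
        (perm₁ * perm₀) ^ (2 * (i.2.2 : ℕ)) := by
      intro i
      change permRep _ = _
      rw [map_mul, map_mul, map_pow, map_pow, map_pow, map_mul, permRep_of_zero, permRep_of_one]
    refine hinj ?_
    change (_ : Equiv.Perm Column) 0 = (_ : Equiv.Perm Column) 0
    rw [← hval, ← hval, h]
  have h1 := Nat.card_le_card_of_injective φ hφ
  simpa using h1

/-! ### Orders and indices in the quotient -/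

section Quotient

variable {M : Subgroup PVGroup} [M.Normal]

/-- The permutation representation of `PVGroup ⧸ M`. -/
def permRepQuotient (M : Subgroup PVGroup) [M.Normal] (hM : M ≤ N 2) :
    PVGroup ⧸ M →* Equiv.Perm Column :=
  QuotientGroup.lift M permRep fun _ hm => N_two_le_ker (hM hm)

theorem permRepQuotient_v_zero (hM : M ≤ N 2) : permRepQuotient M hM (v M 0) = perm₀ :=
  permRep_of_zero

theorem permRepQuotient_v_one (hM : M ≤ N 2) : permRepQuotient M hM (v M 1) = perm₁ :=
  permRep_of_one

/-- Each relation would persist in the permutation representation, where the zero column refutes it.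
-/
theorem generators_ne (hM : M ≤ N 2) :
    v M 0 * v M 0 ≠ 1 ∧ v M 1 * v M 1 ≠ 1 ∧ v M 0 ≠ v M 1 ∧ v M 0 * v M 1 ≠ 1 := by
  have h0 := permRepQuotient_v_zero hM
  have h1 := permRepQuotient_v_one hM
  refine ⟨fun h => ?_, fun h => ?_, fun h => ?_, fun h => ?_⟩ <;>
    replace h := congrArg (fun u => permRepQuotient M hM u 0) h <;>
    simp only [map_mul, map_one, h0, h1] at h <;>
    revert h <;> decide +kernel

/-- The fourth power of each element lies in the kernel of the permutation representation, where
Lagrange's theorem applies. -/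
theorem b_dvd (hM : M ≤ N 2) (j : Fin 4) :
    b M j ∣ 4 * Nat.card (permRepQuotient M hM).ker := by
  refine orderOf_dvd_of_pow_eq_one ?_
  rw [pow_mul]
  have h : ∀ u : PVGroup ⧸ M, permRepQuotient M hM u ^ 4 = 1 →
      (u ^ 4) ^ Nat.card (permRepQuotient M hM).ker = 1 := by
    intro u hu
    have h1 : u ^ 4 ∈ (permRepQuotient M hM).ker := by rw [MonoidHom.mem_ker, map_pow, hu]
    exact congrArg Subtype.val (pow_card_eq_one' (x := (⟨u ^ 4, h1⟩ : (permRepQuotient M hM).ker)))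
  have h0 := permRepQuotient_v_zero hM
  have h1 := permRepQuotient_v_one hM
  refine h _ (Equiv.ext ?_)
  fin_cases j <;> simp only [Fin.reduceFinMk, Matrix.cons_val, map_mul, map_inv, h0, h1] <;>
    decide +kernel

theorem card_eq (hM : M ≤ N 2) : Nat.card (PVGroup ⧸ M) =
    Nat.card permRep.range * Nat.card (permRepQuotient M hM).ker := by
  have h1 : (permRepQuotient M hM).range = permRep.range := by
    ext u
    constructor
    · rintro ⟨q, rfl⟩
      obtain ⟨h, rfl⟩ := QuotientGroup.mk_surjective q
      exact ⟨h, rfl⟩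
    · rintro ⟨h, rfl⟩
      exact ⟨h, rfl⟩
  rw [← h1, ← Subgroup.index_ker, mul_comm, Subgroup.card_mul_index]

/-- For the bound, with `k` the order of the kernel, `b_j ≤ 4k` while the quotient has at least
`32k` elements. -/
theorem orders (hM : M ≤ N 2) (hcard : ∃ t : ℕ, Nat.card (PVGroup ⧸ M) = 2 ^ t) (j : Fin 4) :
    (∃ s : ℕ, a M j = 2 ^ s) ∧ (∃ s : ℕ, b M j = 2 ^ s) ∧ 8 ≤ a M j := by
  obtain ⟨t, ht⟩ := hcard
  have hpos : 0 < Nat.card (PVGroup ⧸ M) := ht ▸ Nat.two_pow_pos t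
  have hdvd : b M j ∣ Nat.card (PVGroup ⧸ M) := orderOf_dvd_natCard _
  have hb : 0 < b M j := Nat.pos_of_dvd_of_pos hdvd hpos
  refine ⟨?_, ?_, ?_⟩
  · obtain ⟨s, -, hs⟩ := (Nat.dvd_prime_pow Nat.prime_two).1 (ht ▸ Nat.div_dvd_of_dvd hdvd)
    exact ⟨s, by rw [a, ht, hs]⟩
  · obtain ⟨s, -, hs⟩ := (Nat.dvd_prime_pow Nat.prime_two).1 (ht ▸ hdvd)
    exact ⟨s, hs⟩
  · have h1 := card_eq hM
    have h2 : 0 < Nat.card (permRepQuotient M hM).ker := by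
      refine Nat.pos_of_ne_zero fun h => ?_
      rw [h, mul_zero] at h1
      omega
    refine (Nat.le_div_iff_mul_le hb).2 ?_
    calc 8 * b M j ≤ 8 * (4 * Nat.card (permRepQuotient M hM).ker) :=
          Nat.mul_le_mul_left _ (Nat.le_of_dvd (by omega) (b_dvd hM j))
      _ = 32 * Nat.card (permRepQuotient M hM).ker := by ring
      _ ≤ _ := h1 ▸ Nat.mul_le_mul_right _ le_card_range_permRep

end Quotient

end PV

theorem mainTheorem4 (Φ : GraphProperty) (M : Subgroup PV.PVGroup) [M.Normal]
    (hM : (∃ i : ℕ, 2 ≤ i ∧ M = PV.N i) ∨ (M ≤ PV.N 2 ∧ ∃ t : ℕ, M.index = 2 ^ t)) :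
    (∃ coeff : Fracture (PV.graph M) → ℤ,
      IsCoefficientFunction Φ (PV.graph M) coeff ∧
      (∀ coeff', IsCoefficientFunction Φ (PV.graph M) coeff' → coeff' = coeff) ∧
      coeff ⊤ ≡
        Φ.val ((copies (PV.a M 0) (SimpleGraph.cycleGraph (PV.b M 0))).sum
            (copies (PV.a M 1) (SimpleGraph.cycleGraph (PV.b M 1))))
          + Φ.val (copies (PV.a M 2) (SimpleGraph.cycleGraph (2 * PV.b M 2)))
          + Φ.val (copies (PV.a M 3) (SimpleGraph.cycleGraph (2 * PV.b M 3)))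
          + Φ.val (PV.graph M) [ZMOD 2]) ∧
    ∀ j : Fin 4, (∃ s : ℕ, PV.a M j = 2 ^ s) ∧ (∃ s : ℕ, PV.b M j = 2 ^ s) ∧ 8 ≤ PV.a M j := by
  -- The members of the tower are a special case of the second alternative.
  have hM' : M ≤ PV.N 2 ∧ ∃ t : ℕ, M.index = 2 ^ t := by
    rcases hM with ⟨i, hi, rfl⟩ | h
    · exact ⟨PV.N_le_N_two hi, PV.index_N i⟩
    · exact h
  obtain ⟨hle, t, ht⟩ := hM'
  have hcard : Nat.card (PV.PVGroup ⧸ M) = 2 ^ t := ht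
  have : Finite (PV.PVGroup ⧸ M) := Nat.finite_of_card_ne_zero (by rw [hcard]; positivity)
  have hK : IsPGroup 2 (PV.PVGroup ⧸ M) := IsPGroup.of_card hcard
  refine ⟨?_, PV.orders hle ⟨t, hcard⟩⟩
  classical
  have (S : Type) [Finite S] : Finite (Setoid S) := Setoid.finite_setoid S
  have := Fintype.ofFinite (Fracture (PV.graph M))
  obtain ⟨coeff, hcoeff, huniq⟩ := existsUnique_sum_le fun σ : Fracture (PV.graph M) =>
    Φ.val (fracturedGraph (PV.graph M) σ)
  have hcoeff' := (isCoefficientFunction_iff Φ coeff).2 hcoeff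
  obtain ⟨h1, h2, h3, h4⟩ := PV.generators_ne hle
  exact ⟨coeff, hcoeff', fun c hc => huniq c ((isCoefficientFunction_iff Φ c).1 hc),
    coefficient_top_fourGenerators hK h1 h2 h3 h4 Φ coeff hcoeff'⟩
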